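/- Let $A$ be a finite-dimensional algebra over a field $\Bbbk$ and let $\operatorname{mod}A$ be the category of finitely generated right $A$-modules. Let $(e_1,\dots,e_n)$ be an ordered set of pairwise orthogonal primitive idempotents of $A$ such that $S(i):=\operatorname{top}e_iA$ $(1\le i\le n)$ is a complete, irredundant list of representatives of the isomorphism classes of simple right $A$-modules (if $A$ is basic, any decomposition of $1$ into primitive orthogonal idempotents will do). For $M\in\operatorname{mod}A$, let $\operatorname{add}M$ be the class of direct summands of finite direct sums of copies of $M$. Let $\mathcal F(M)$ be the class of modules $X$ for which there are $l>0$ and a filtration $0=X_0\subseteq X_1\subseteq\dots\subseteq X_l=X$ with $X_k/X_{k-1}\in\operatorname{add}M$ for all $k$. For a finite family of modules put $\mathcal F(M_j\mid j\in J):=\mathcal F(\bigoplus_{j\in J}M_j)$. The standard module $\Delta(i)$ is the maximal factor module of $e_iA$ lying in $\mathcal F(S(1),\dots,S(i))$, and the proper standard module $\overline\Delta(i)$ is the maximal factor module of $\Delta(i)$ whose radical lies in $\mathcal F(S(1),\dots,S(i-1))$. A module is a *brick* if its endomorphism ring is a division ring, and a *stone* if it is indecomposable and $\operatorname{Ext}^1_A(M,M)=0$.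 Let $\Theta=(\Theta(1),\dots,\Theta(n))$ be an ordered set of modules in $\operatorname{mod}A$. For indecomposable modules $P(1),\dots,P(n)\in\operatorname{mod}A$ and $\mathbb P=(P(1),\dots,P(n))$, the pair $(\Theta,\mathbb P)$ is a *mixed stratifying system* in $\operatorname{mod}A$ if 1. each $\Theta(i)$ is a brick or a stone; 2. $\operatorname{Hom}_A(\Theta(i),\Theta(j))=0$ for $i>j$; 3. for each $i$ there is a short exact sequence $0\to K(i)\to P(i)\to\Theta(i)\to0$ with $K(i)\in\mathcal F(\Theta(j)\mid j\ge i)$ and $\operatorname{Ext}^1_A(P(i),X)=0$ for all $X\in\mathcal F(\Theta)$ (the further condition, that the negative first extensions of $\Theta$ by $\Theta$ vanish, holds automatically in $\operatorname{mod}A$, where these are zero by definition). Dually, for indecomposable modules $I(1),\dots,I(n)\in\operatorname{mod}A$ and $\mathbb I=(I(1),\dots,I(n))$, the pair $(\Theta,\mathbb I)$ is a *mixed costratifying system* if conditions 1 and 2 hold and for each $i$ there is a short exact sequence $0\to\Theta(i)\to I(i)\to C(i)\to0$ with $C(i)\in\mathcal F(\Theta(j)\mid j\le i)$ and $\operatorname{Ext}^1_A(X,I(i))=0$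 for all $X\in\mathcal F(\Theta)$. The triple $(\Theta,\mathbb P,\mathbb I)$ is a *mixed bistratifying system* if $(\Theta,\mathbb P)$ is a mixed stratifying system and $(\Theta,\mathbb I)$ is a mixed costratifying system. **Statement.** Let $\Theta=(\Theta(1),\dots,\Theta(n))$, where for each $i$ the module $\Theta(i)$ is (isomorphic to) $\Delta(i)$ or $\overline\Delta(i)$. Then there is $\mathbb P=(P(1),\dots,P(n))$ such that $\bigoplus_iP(i)$ is a projective object of $\mathcal F(\Theta)$, i.e. it lies in $\mathcal F(\Theta)$ and $\operatorname{Ext}^1_A(\bigoplus_iP(i),X)=0$ for all $X\in\mathcal F(\Theta)$, and such that $(\Theta,\mathbb P)$ is a mixed stratifying system in $\operatorname{mod}A$. If in addition $\Theta(i)\cong\Delta(i)$ for all $i$, then there is moreover $\mathbb I=(I(1),\dots,I(n))$ such that $\bigoplus_iI(i)$ is an injective object of $\mathcal F(\Theta)$, i.e. it lies in $\mathcal F(\Theta)$ and $\operatorname{Ext}^1_A(X,\bigoplus_iI(i))=0$ for all $X\in\mathcal F(\Theta)$, and such that $(\Theta,\mathbb P,\mathbb I)$, with the same $\mathbb P$,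 is a mixed bistratifying system in $\operatorname{mod}A$. -/

import Mathlib

open CategoryTheory CategoryTheory.Limits MulOpposite

namespace MixedStrat

universe u

noncomputable section

section ModuleCategory

variable {R : Type u} [Ring R]

/-- The direct sum of a finite family of modules. -/
def directSum {ι : Type} [Finite ι] (M : ι → ModuleCat.{u} R) : ModuleCat.{u} R :=
  ModuleCat.of R (∀ j, M j)

/-- `add M`: the direct summands of finite direct sums of copies of `M`. -/
def addClosure (M : ModuleCat.{u} R) : ObjectProperty (ModuleCat.{u} R) := fun X =>
  ∃ m : ℕ, Nonempty (Retract X (directSum fun _ : Fin m => M))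

/-- `X * Y`: the modules `M` in the middle of a short exact sequence `0 → X → M → Y → 0`
with `X` in the first and `Y` in the second subcategory. -/
def star (𝓧 𝓨 : ObjectProperty (ModuleCat.{u} R)) : ObjectProperty (ModuleCat.{u} R) := fun M =>
  ∃ (X Y : ModuleCat.{u} R) (f : X ⟶ M) (g : M ⟶ Y) (w : f ≫ g = 0),
    (ShortComplex.mk f g w).ShortExact ∧ 𝓧 X ∧ 𝓨 Y

/-- `starIter 𝓧 l` is `𝓧 * ⋯ * 𝓧` with `l + 1` factors. -/
def starIter (𝓧 : ObjectProperty (ModuleCat.{u} R)) : ℕ → ObjectProperty (ModuleCat.{u} R)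
  | 0 => 𝓧
  | l + 1 => star 𝓧 (starIter 𝓧 l)

/-- `F(M)`: the union over all `l > 0` of the `l`-fold products `add M * ⋯ * add M`. -/
def filt (M : ModuleCat.{u} R) : ObjectProperty (ModuleCat.{u} R) := fun X =>
  ∃ l : ℕ, starIter (addClosure M) l X

/-- `F(Θ)` for a finite family `Θ`, which is identified with the direct sum of its members. -/
def filtFamily {ι : Type} [Finite ι] (Θ : ι → ModuleCat.{u} R) : ObjectProperty (ModuleCat.{u} R) :=
  filt (directSum Θ)

/-- The modules `M` with `Ext¹(M, X) = 0` for all `X` in the given subcategory. -/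
def leftExtPerp (𝓧 : ObjectProperty (ModuleCat.{u} R)) : ObjectProperty (ModuleCat.{u} R) :=
  fun M => ∀ X, 𝓧 X → Subsingleton (Abelian.Ext.{u} M X 1)

/-- The modules `M` with `Ext¹(X, M) = 0` for all `X` in the given subcategory. -/
def rightExtPerp (𝓧 : ObjectProperty (ModuleCat.{u} R)) : ObjectProperty (ModuleCat.{u} R) :=
  fun M => ∀ X, 𝓧 X → Subsingleton (Abelian.Ext.{u} X M 1)

/-- `P` is a projective object in the (extension-closed) subcategory `𝓧`. -/
def IsProjectiveIn (𝓧 : ObjectProperty (ModuleCat.{u} R)) (P : ModuleCat.{u} R) : Prop :=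
  𝓧 P ∧ leftExtPerp 𝓧 P

/-- `I` is an injective object in the (extension-closed) subcategory `𝓧`. -/
def IsInjectiveIn (𝓧 : ObjectProperty (ModuleCat.{u} R)) (I : ModuleCat.{u} R) : Prop :=
  𝓧 I ∧ rightExtPerp 𝓧 I

/-- A brick: a nonzero module whose nonzero endomorphisms are invertible, i.e. whose endomorphism
ring is a division ring. -/
def IsBrick (M : ModuleCat.{u} R) : Prop :=
  ¬ IsZero M ∧ ∀ f : M ⟶ M, f ≠ 0 → IsIso f

/-- A stone: an indecomposable module without self-extensions. -/
def IsStone (M : ModuleCat.{u} R) : Prop :=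
  Indecomposable M ∧ Subsingleton (Abelian.Ext.{u} M M 1)

/-- The negative first extension of an exact category, here of modules: the zero bifunctor. -/
def negExt : (ModuleCat.{u} R)ᵒᵖ ⥤ ModuleCat.{u} R ⥤ AddCommGrpCat.{u} :=
  (Functor.const _).obj ((Functor.const _).obj (AddCommGrpCat.of PUnit))

/-- `(Θ, P)` is a mixed stratifying system of size `t` in the category of finitely generated
`R`-modules, with its short exact sequences as conflations, `Ext¹` as first extensions
and zero negative first extensions. -/
structure IsMixedStratifyingSystem {t : ℕ} (Θ P : Fin t → ModuleCat.{u} R) : Prop where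
  finite_left : ∀ i, Module.Finite R (Θ i)
  finite_right : ∀ i, Module.Finite R (P i)
  indecomposable : ∀ i, Indecomposable (P i)
  brick_or_stone : ∀ i, IsBrick (Θ i) ∨ IsStone (Θ i)
  hom_eq_zero : ∀ i j, j < i → ∀ f : Θ i ⟶ Θ j, f = 0
  conflation : ∀ i, ∃ (K : ModuleCat.{u} R) (f : K ⟶ P i) (α : P i ⟶ Θ i) (w : f ≫ α = 0),
    (ShortComplex.mk f α w).ShortExact ∧
      filtFamily (fun j : {j : Fin t // i ≤ j} => Θ j) K ∧ leftExtPerp (filtFamily Θ) (P i)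
  negExt_eq_zero : IsZero ((negExt.obj (.op (directSum Θ))).obj (directSum Θ))

/-- `(Θ, I)` is a mixed costratifying system of size `t` in the category of finitely generated
`R`-modules. -/
structure IsMixedCostratifyingSystem {t : ℕ} (Θ I : Fin t → ModuleCat.{u} R) : Prop where
  finite_left : ∀ i, Module.Finite R (Θ i)
  finite_right : ∀ i, Module.Finite R (I i)
  indecomposable : ∀ i, Indecomposable (I i)
  brick_or_stone : ∀ i, IsBrick (Θ i) ∨ IsStone (Θ i)
  hom_eq_zero : ∀ i j, j < i → ∀ f : Θ i ⟶ Θ j, f = 0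
  conflation : ∀ i, ∃ (C : ModuleCat.{u} R) (β : Θ i ⟶ I i) (g : I i ⟶ C) (w : β ≫ g = 0),
    (ShortComplex.mk β g w).ShortExact ∧
      rightExtPerp (filtFamily Θ) (I i) ∧ filtFamily (fun j : {j : Fin t // j ≤ i} => Θ j) C
  negExt_eq_zero : IsZero ((negExt.obj (.op (directSum Θ))).obj (directSum Θ))

/-- `(Θ, P, I)` is a mixed bistratifying system in the category of finitely generated
`R`-modules. -/
structure IsMixedBistratifyingSystem {t : ℕ} (Θ P I : Fin t → ModuleCat.{u} R) : Prop where
  stratifying : IsMixedStratifyingSystem Θ P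
  costratifying : IsMixedCostratifyingSystem Θ I

/-- The radical of a module, as a module. -/
def rad (M : ModuleCat.{u} R) : ModuleCat.{u} R :=
  ModuleCat.of R (Module.jacobson R M)

/-- The top `M / rad M` of a module. -/
def top (M : ModuleCat.{u} R) : ModuleCat.{u} R :=
  ModuleCat.of R (M ⧸ Module.jacobson R M)

/-- The maximal factor module of `M` with a property `𝓟` of modules: the quotient by the
intersection of all submodules `U` such that `M ⧸ U` has the property. In both uses below this
intersection is the smallest such `U`. -/
def maxFactor (𝓟 : ObjectProperty (ModuleCat.{u} R)) (M : ModuleCat.{u} R) : ModuleCat.{u} R :=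
  ModuleCat.of R (M ⧸ sInf {U : Submodule R M | 𝓟 (ModuleCat.of R (M ⧸ U))})

end ModuleCategory

section Algebra

variable {A : Type u} [Ring A]

/-- The right ideal `eA`, as a right `A`-module, i.e. as a module over `Aᵐᵒᵖ`. -/
def idealOf (e : A) : ModuleCat.{u} Aᵐᵒᵖ :=
  ModuleCat.of Aᵐᵒᵖ (Submodule.span Aᵐᵒᵖ ({e} : Set A))

/-- The right module `S(i) = top (e i A)`. -/
def simpleAt {n : ℕ} (e : Fin n → A) (i : Fin n) : ModuleCat.{u} Aᵐᵒᵖ :=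
  top (idealOf (e i))

/-- A primitive idempotent: a nonzero idempotent which is not the sum of two nonzero orthogonal
idempotents. -/
def IsPrimitiveIdem (e : A) : Prop :=
  IsIdempotentElem e ∧ e ≠ 0 ∧ ∀ f g : A, IsIdempotentElem f → IsIdempotentElem g →
    f * g = 0 → g * f = 0 → e = f + g → f = 0 ∨ g = 0

/-- `(e 1, …, e n)` is a complete ordered set of primitive orthogonal idempotents of `A`, in the
sense that the modules `S(i)` are representatives of the isomorphism classes of simple right
`A`-modules. For a basic algebra, every decomposition of `1` into primitive orthogonal idempotents
has this property. -/
structure IsCompletePrimitive {n : ℕ} (e : Fin n → A) : Prop where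
  orthogonal : OrthogonalIdempotents e
  primitive : ∀ i, IsPrimitiveIdem (e i)
  injective : ∀ i j, Nonempty (simpleAt e i ≅ simpleAt e j) → i = j
  exhaustive : ∀ S : ModuleCat.{u} Aᵐᵒᵖ, IsSimpleModule Aᵐᵒᵖ S → ∃ i, Nonempty (S ≅ simpleAt e i)

/-- The standard module `Δ(i)`: the maximal factor module of `e i A` that lies in
`F(S(1) ⊕ ⋯ ⊕ S(i))`. -/
def standard {n : ℕ} (e : Fin n → A) (i : Fin n) : ModuleCat.{u} Aᵐᵒᵖ :=
  maxFactor (filtFamily fun j : {j : Fin n // j ≤ i} => simpleAt e j) (idealOf (e i))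

/-- The proper standard module: the maximal factor module of `Δ(i)` whose radical lies in
`F(S(1) ⊕ ⋯ ⊕ S(i-1))`. -/
def properStandard {n : ℕ} (e : Fin n → A) (i : Fin n) : ModuleCat.{u} Aᵐᵒᵖ :=
  maxFactor (fun M => filtFamily (fun j : {j : Fin n // j < i} => simpleAt e j) (rad M))
    (standard e i)

end Algebra

end

end MixedStrat

/-! All information about the (proper) standard modules is read off from the idempotents. A module
of finite length lies in F(S(j) | p j) exactly when it is annihilated by all e_k with p k false.
Hence Δ(i) is e_iA modulo the submodule N generated by all elements x e_k with k > i. This N has no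
nonzero map to a module Y with Y e_k = 0 for k > i, so projectivity of e_iA gives Ext¹(Δ(i), Y) = 0
for such Y; in particular Δ(i) is a stone. The proper standard module arises likewise from Δ(i) and
its radical; it is a brick, and Ext¹ into Y vanishes if Y e_k = 0 for all k ≥ i. Thus Hom(Θ(i),
Θ(j)) = Ext¹(Θ(i), Θ(j)) = 0 for i > j (`isExceptionalFamily_of_standardLike`).

For such a family P(i) is built upwards from Θ(i): for m = i, ..., n the current module E is
replaced by an extension E' of E by an iterated self-extension K of Θ(m) with Ext¹(E', Θ(m)) = 0.
Vanishing already achieved against Θ(k), k < m, survives because Ext¹(Θ(m), Θ(k)) = 0. If Θ(m) is a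
stone, the universal extension does this (`exists_universal_extension`). A brick may have
self-extensions, so nonsplit extensions are repeated, and a length bound makes the process stop
(`exists_brick_extension`). When all Θ(i) are stones, universal coextensions, taken downwards, give
I(i).

Indecomposability comes from passing to direct summands (`exists_indec_extension`). The kernels then
are only retracts of iterated self-extensions of Θ(m), which is why `RClosure` is used. It stays
inside F(Θ): for a stone it is contained in add Θ(m), for a brick the iterated self-extensions are
already closed under retracts (`retractClosed_ExtClosure`). -/

namespace MixedStrat

universe u v

set_option autoImplicit false

/-! ### Short exact sequences and vanishing of Ext¹ -/

section Ext

variable {R : Type u} [Ring R]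

/-- The linear maps `f` and `g` form a short exact sequence `0 → X → Y → Z → 0`. -/
structure IsSES {X Y Z : ModuleCat.{u} R} (f : X →ₗ[R] Y) (g : Y →ₗ[R] Z) : Prop where
  inj : Function.Injective f
  exact : Function.Exact f g
  surj : Function.Surjective g

/-- `Ext¹(M, X) = 0`. -/
def ExtVanish (M X : ModuleCat.{u} R) : Prop := Subsingleton (Abelian.Ext.{u} M X 1)

variable {X Y Z M N : ModuleCat.{u} R}

namespace IsSES

variable {f : X →ₗ[R] Y} {g : Y →ₗ[R] Z}

theorem comp_apply (h : IsSES f g) (x : X) : g (f x) = 0 := h.exact.apply_apply_eq_zero x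

theorem ofHom_comp (h : IsSES f g) : (ModuleCat.ofHom f : X ⟶ Y) ≫ (ModuleCat.ofHom g : Y ⟶ Z) = 0 := by
  ext x; exact h.comp_apply x

theorem shortExact (h : IsSES f g) :
    (ShortComplex.mk (ModuleCat.ofHom f : X ⟶ Y) (ModuleCat.ofHom g : Y ⟶ Z)
      h.ofHom_comp).ShortExact := by
  have : Mono (ModuleCat.ofHom f : X ⟶ Y) := (ModuleCat.mono_iff_injective _).2 h.inj
  have : Epi (ModuleCat.ofHom g : Y ⟶ Z) := (ModuleCat.epi_iff_surjective _).2 h.surj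
  refine ⟨?_⟩
  rw [ShortComplex.ShortExact.moduleCat_exact_iff_function_exact]
  exact h.exact

/-- Linear maps vanishing on the image of `f` factor through `g`. -/
theorem exists_desc (h : IsSES f g) (φ : Y →ₗ[R] M) (hφ : ∀ x, φ (f x) = 0) :
    ∃ ψ : Z →ₗ[R] M, ∀ y, ψ (g y) = φ y := by
  have hk : LinearMap.ker g ≤ LinearMap.ker φ := by
    intro y hy
    obtain ⟨x, rfl⟩ := (h.exact y).1 hy
    exact hφ x
  refine ⟨(LinearMap.ker g).liftQ φ hk ∘ₗ (g.quotKerEquivOfSurjective h.surj).symm.toLinearMap, ?_⟩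
  intro y
  have : (g.quotKerEquivOfSurjective h.surj).symm (g y) = Submodule.Quotient.mk y := by
    rw [LinearEquiv.symm_apply_eq]; rfl
  simp [this]

/-- Linear maps killed by `g` factor through `f`. -/
theorem exists_lift (h : IsSES f g) (φ : M →ₗ[R] Y) (hφ : ∀ x, g (φ x) = 0) :
    ∃ ψ : M →ₗ[R] X, ∀ x, f (ψ x) = φ x := by
  have hr : ∀ x, φ x ∈ LinearMap.range f := fun x => (h.exact _).1 (hφ x)
  refine ⟨(LinearEquiv.ofInjective f h.inj).symm.toLinearMap ∘ₗ φ.codRestrict _ hr, fun x => ?_⟩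
  have := (LinearEquiv.ofInjective f h.inj).apply_symm_apply ⟨φ x, hr x⟩
  exact congrArg Subtype.val this

theorem of_linearEquiv (e : X ≃ₗ[R] Y) (hZ : Subsingleton Z) :
    IsSES (e : X →ₗ[R] Y) (0 : Y →ₗ[R] Z) :=
  ⟨e.injective, fun y => ⟨fun _ => ⟨e.symm y, by simp⟩, fun _ => Subsingleton.elim _ _⟩,
    fun z => ⟨0, Subsingleton.elim _ _⟩⟩

theorem ker_subtype {g : Y →ₗ[R] Z} (hg : Function.Surjective g) :
    IsSES (X := ModuleCat.of R (LinearMap.ker g)) (LinearMap.ker g).subtype g :=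
  ⟨Subtype.val_injective, LinearMap.exact_subtype_ker_map g, hg⟩

theorem mkQ_range {f : X →ₗ[R] Y} (hf : Function.Injective f) :
    IsSES (Z := ModuleCat.of R (Y ⧸ LinearMap.range f)) f (LinearMap.range f).mkQ :=
  ⟨hf, LinearMap.exact_map_mkQ_range f, Submodule.mkQ_surjective _⟩

theorem mkQ (U : Submodule R Y) :
    IsSES (X := ModuleCat.of R U) (Z := ModuleCat.of R (Y ⧸ U)) U.subtype U.mkQ :=
  ⟨Subtype.val_injective, LinearMap.exact_subtype_mkQ U, Submodule.mkQ_surjective _⟩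

theorem prod : IsSES (Y := ModuleCat.of R (X × Z)) (LinearMap.inl R X Z) (LinearMap.snd R X Z) :=
  ⟨LinearMap.inl_injective, .inl_snd, LinearMap.snd_surjective⟩

end IsSES

namespace ExtVanish

open Abelian

theorem of_ses_right {f : X →ₗ[R] Y} {g : Y →ₗ[R] Z} (h : IsSES f g) (hX : ExtVanish M X)
    (hZ : ExtVanish M Z) : ExtVanish M Y := by
  have := hX; have := hZ; unfold ExtVanish at *
  refine subsingleton_of_forall_eq 0 fun ξ => ?_
  obtain ⟨η, rfl⟩ := Ext.covariant_sequence_exact₂ M h.shortExact ξ (Subsingleton.elim _ _)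
  rw [Subsingleton.elim η 0, Ext.zero_comp]

theorem of_ses_left {f : X →ₗ[R] Y} {g : Y →ₗ[R] Z} (h : IsSES f g) (hX : ExtVanish X M)
    (hZ : ExtVanish Z M) : ExtVanish Y M := by
  have := hX; have := hZ; unfold ExtVanish at *
  refine subsingleton_of_forall_eq 0 fun ξ => ?_
  obtain ⟨η, rfl⟩ := Ext.contravariant_sequence_exact₂ h.shortExact M ξ (Subsingleton.elim _ _)
  rw [Subsingleton.elim η 0, Ext.comp_zero]

/-- If `Ext¹(Y, M) = 0`, every map `X → M` extends to `Y`, then `Ext¹(Z, M) = 0`. -/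
theorem of_extends {f : X →ₗ[R] Y} {g : Y →ₗ[R] Z} (h : IsSES f g) (hY : ExtVanish Y M)
    (he : ∀ φ : X →ₗ[R] M, ∃ ψ : Y →ₗ[R] M, ∀ x, ψ (f x) = φ x) : ExtVanish Z M := by
  have := hY; unfold ExtVanish at *
  refine subsingleton_of_forall_eq 0 fun ξ => ?_
  obtain ⟨η, rfl⟩ := Ext.contravariant_sequence_exact₃ h.shortExact M ξ (Subsingleton.elim _ _)
    (add_zero 1)
  obtain ⟨φ, rfl⟩ := (Ext.mk₀_bijective _ _).2 η
  obtain ⟨ψ, hψ⟩ := he φ.hom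
  have : φ = (ModuleCat.ofHom f : X ⟶ Y) ≫ (ModuleCat.ofHom ψ : Y ⟶ M) := by
    ext x; exact (hψ x).symm
  rw [this, ← Ext.mk₀_comp_mk₀]
  exact h.shortExact.extClass_comp_assoc _

theorem exists_lift {f : X →ₗ[R] Y} {g : Y →ₗ[R] Z} (h : IsSES f g) (hM : ExtVanish M X)
    (φ : M →ₗ[R] Z) : ∃ ψ : M →ₗ[R] Y, ∀ x, g (ψ x) = φ x := by
  have := hM; unfold ExtVanish at this
  obtain ⟨η, hη⟩ := Ext.covariant_sequence_exact₃ M h.shortExact (Ext.mk₀ (ModuleCat.ofHom φ))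
    (zero_add 1) (Subsingleton.elim _ _)
  obtain ⟨ψ, rfl⟩ := (Ext.mk₀_bijective _ _).2 η
  rw [Ext.mk₀_comp_mk₀] at hη
  have := (Ext.mk₀_bijective _ _).1 hη
  exact ⟨ψ.hom, fun x => congrArg (fun t : M ⟶ Z => t.hom x) this⟩

theorem exists_extend {f : X →ₗ[R] Y} {g : Y →ₗ[R] Z} (h : IsSES f g) (hM : ExtVanish Z M)
    (φ : X →ₗ[R] M) : ∃ ψ : Y →ₗ[R] M, ∀ x, ψ (f x) = φ x := by
  have := hM; unfold ExtVanish at this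
  obtain ⟨η, hη⟩ := Ext.contravariant_sequence_exact₁ h.shortExact M (Ext.mk₀ (ModuleCat.ofHom φ))
    (add_zero 1) (Subsingleton.elim _ _)
  obtain ⟨ψ, rfl⟩ := (Ext.mk₀_bijective _ _).2 η
  rw [Ext.mk₀_comp_mk₀] at hη
  have := (Ext.mk₀_bijective _ _).1 hη
  exact ⟨ψ.hom, fun x => congrArg (fun t : X ⟶ M => t.hom x) this⟩

theorem retract_left (i : X →ₗ[R] Y) (r : Y →ₗ[R] X) (hri : ∀ x, r (i x) = x)
    (hY : ExtVanish Y M) : ExtVanish X M := by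
  have := hY; unfold ExtVanish at *
  refine subsingleton_of_forall_eq 0 fun ξ => ?_
  have hid : (ModuleCat.ofHom i : X ⟶ Y) ≫ (ModuleCat.ofHom r : Y ⟶ X) = 𝟙 X := by
    ext x; exact hri x
  rw [← Ext.mk₀_id_comp ξ, ← hid, ← Ext.mk₀_comp_mk₀_assoc,
    Subsingleton.elim ((Ext.mk₀ (ModuleCat.ofHom r : Y ⟶ X)).comp ξ (zero_add 1)) 0, Ext.comp_zero]

theorem retract_right (i : X →ₗ[R] Y) (r : Y →ₗ[R] X) (hri : ∀ x, r (i x) = x)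
    (hY : ExtVanish M Y) : ExtVanish M X := by
  have := hY; unfold ExtVanish at *
  refine subsingleton_of_forall_eq 0 fun ξ => ?_
  have hid : (ModuleCat.ofHom i : X ⟶ Y) ≫ (ModuleCat.ofHom r : Y ⟶ X) = 𝟙 X := by
    ext x; exact hri x
  rw [← Ext.comp_mk₀_id ξ, ← hid, ← Ext.mk₀_comp_mk₀, ← Ext.comp_assoc_of_third_deg_zero,
    Subsingleton.elim (ξ.comp (Ext.mk₀ (ModuleCat.ofHom i : X ⟶ Y)) (add_zero 1)) 0, Ext.zero_comp]

theorem of_projective [Module.Projective R X] : ExtVanish X M := by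
  have : Projective X := (IsProjective.iff_projective X).1 inferInstance
  exact Ext.subsingleton_of_projective X M 0

theorem of_subsingleton_left [Subsingleton X] : ExtVanish X M :=
  have : Projective X := (ModuleCat.isZero_of_subsingleton X).projective
  Ext.subsingleton_of_projective X M 0

theorem of_subsingleton_right [Subsingleton X] : ExtVanish M X :=
  subsingleton_of_forall_eq 0 fun ξ => by
    rw [← Ext.comp_mk₀_id ξ, (ModuleCat.isZero_of_subsingleton X).eq_zero_of_src (𝟙 X),
      Ext.mk₀_zero, Ext.comp_zero]

end ExtVanish

end Ext

/-! ### Classes closed under extensions and retracts, and F(Θ) -/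

section Closure

variable {R : Type u} [Ring R]

variable {X Y Z M N : ModuleCat.{u} R}

/-- If `X₁ → X → X₂` and `X → M → Y` are short exact, then so are `X₁ → M → Q` and `X₂ → Q → Y`
for a suitable `Q`. -/
theorem IsSES.exists_quotient {X₁ X₂ : ModuleCat.{u} R} {i : X₁ →ₗ[R] X} {p : X →ₗ[R] X₂}
    {f : X →ₗ[R] M} {g : M →ₗ[R] Y} (h₁ : IsSES i p) (h : IsSES f g) :
    ∃ (Q : ModuleCat.{u} R) (q : M →ₗ[R] Q) (f' : X₂ →ₗ[R] Q) (g' : Q →ₗ[R] Y),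
      IsSES (f ∘ₗ i) q ∧ IsSES f' g' := by
  have h₂ : IsSES (Z := ModuleCat.of R (M ⧸ LinearMap.range (f ∘ₗ i))) (f ∘ₗ i) _ :=
    IsSES.mkQ_range (h.inj.comp h₁.inj)
  obtain ⟨g', hg'⟩ := h₂.exists_desc g (fun x => h.comp_apply (i x))
  obtain ⟨f', hf'⟩ := h₁.exists_desc ((LinearMap.range (f ∘ₗ i)).mkQ ∘ₗ f :
    X →ₗ[R] ModuleCat.of R (M ⧸ LinearMap.range (f ∘ₗ i))) (fun x => h₂.comp_apply x)
  refine ⟨_, _, f', g', h₂, ⟨?_, ?_, ?_⟩⟩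
  · rw [injective_iff_map_eq_zero]
    intro y hy
    obtain ⟨x, rfl⟩ := h₁.surj y
    rw [hf'] at hy
    obtain ⟨z, hz⟩ := (h₂.exact _).1 hy
    rw [← h.inj hz, h₁.comp_apply]
  · intro y
    obtain ⟨m, rfl⟩ := h₂.surj y
    rw [hg']
    constructor
    · intro hm
      obtain ⟨x, rfl⟩ := (h.exact _).1 hm
      exact ⟨p x, hf' x⟩
    · rintro ⟨x, hx⟩
      obtain ⟨x, rfl⟩ := h₁.surj x
      rw [hf'] at hx
      rw [← hg', ← hx]
      change g' ((LinearMap.range (f ∘ₗ i)).mkQ (f x)) = 0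
      rw [hg', h.comp_apply]
  · intro y
    obtain ⟨m, rfl⟩ := h.surj y
    exact ⟨_, hg' m⟩

/-- The kernel of a composition of surjections is an extension of the kernels. -/
theorem IsSES.exists_comp {K₁ K₂ E₁ E₂ E : ModuleCat.{u} R} {f₂ : K₂ →ₗ[R] E₂} {g₂ : E₂ →ₗ[R] E₁}
    {f₁ : K₁ →ₗ[R] E₁} {g₁ : E₁ →ₗ[R] E} (h₂ : IsSES f₂ g₂) (h₁ : IsSES f₁ g₁) :
    ∃ (K : ModuleCat.{u} R) (f : K →ₗ[R] E₂) (i : K₂ →ₗ[R] K) (p : K →ₗ[R] K₁),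
      IsSES f (g₁ ∘ₗ g₂) ∧ IsSES i p := by
  have h : IsSES (X := ModuleCat.of R (LinearMap.ker (g₁ ∘ₗ g₂))) _ (g₁ ∘ₗ g₂) :=
    IsSES.ker_subtype (h₁.surj.comp h₂.surj)
  obtain ⟨i, hi⟩ := h.exists_lift f₂ (fun x => by
    simp [h₂.comp_apply])
  obtain ⟨p, hp⟩ := h₁.exists_lift (g₂ ∘ₗ (LinearMap.ker (g₁ ∘ₗ g₂)).subtype :
    ModuleCat.of R (LinearMap.ker (g₁ ∘ₗ g₂)) →ₗ[R] E₁) (fun x => h.comp_apply x)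
  refine ⟨_, _, i, p, h, ⟨?_, ?_, ?_⟩⟩
  · intro x y hxy
    apply h₂.inj
    rw [← hi, ← hi, hxy]
  · intro x
    rw [← h₁.inj.eq_iff, map_zero, hp]
    constructor
    · intro hx
      obtain ⟨y, hy⟩ := (h₂.exact _).1 hx
      exact ⟨y, h.inj (by rw [hi, hy])⟩
    · rintro ⟨y, rfl⟩
      rw [LinearMap.comp_apply, hi, h₂.comp_apply]
  · intro y
    obtain ⟨z, hz⟩ := h₂.surj (f₁ y)
    refine ⟨⟨z, by simp [hz, h₁.comp_apply]⟩, h₁.inj ?_⟩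
    rw [hp]; exact hz

/-- A property of modules which holds for zero modules and is closed under extensions. -/
structure ExtClosed (𝓠 : ObjectProperty (ModuleCat.{u} R)) : Prop where
  zero : ∀ X : ModuleCat.{u} R, Subsingleton X → 𝓠 X
  ext : ∀ {X Y Z : ModuleCat.{u} R} {f : X →ₗ[R] Y} {g : Y →ₗ[R] Z}, IsSES f g → 𝓠 X → 𝓠 Z → 𝓠 Y

/-- A property of modules which is closed under retracts. -/
def RetractClosed (𝓠 : ObjectProperty (ModuleCat.{u} R)) : Prop :=
  ∀ ⦃X Y : ModuleCat.{u} R⦄ (i : X →ₗ[R] Y) (r : Y →ₗ[R] X), (∀ x, r (i x) = x) → 𝓠 Y → 𝓠 X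

namespace ExtClosed

variable {𝓠 : ObjectProperty (ModuleCat.{u} R)}

theorem of_linearEquiv (h : ExtClosed 𝓠) (e : X ≃ₗ[R] Y) (hX : 𝓠 X) : 𝓠 Y :=
  h.ext (IsSES.of_linearEquiv (Z := ModuleCat.of R PUnit) e inferInstance) hX
    (h.zero _ inferInstance)

theorem pi_fin (h : ExtClosed 𝓠) : ∀ {n : ℕ} (M : Fin n → ModuleCat.{u} R), (∀ i, 𝓠 (M i)) →
    𝓠 (directSum M)
  | 0, M, _ => h.zero _ (inferInstanceAs (Subsingleton (∀ i : Fin 0, M i)))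
  | n + 1, M, hM => by
    refine h.ext (X := M 0) (Z := directSum fun i : Fin n => M i.succ)
      (f := LinearMap.single R (fun i => M i) 0)
      (g := LinearMap.pi fun i => LinearMap.proj i.succ) ⟨?_, ?_, ?_⟩ (hM 0)
      (h.pi_fin _ fun i => hM i.succ)
    · exact Pi.single_injective (M := fun i => M i) 0
    · intro x
      constructor
      · intro hx
        refine ⟨x 0, funext fun i => ?_⟩
        refine Fin.cases ?_ (fun j => ?_) i
        · exact Pi.single_eq_same (M := fun i => M i) 0 (x 0)
        · exact (Pi.single_eq_of_ne (M := fun i => M i) (Fin.succ_ne_zero j) (x 0)).trans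
            (congrFun hx j).symm
      · rintro ⟨y, rfl⟩
        funext j
        exact Pi.single_eq_of_ne (M := fun i => M i) (Fin.succ_ne_zero j) y
    · intro y
      exact ⟨Fin.cons (α := fun i => M i) 0 y, rfl⟩

theorem pi (h : ExtClosed 𝓠) {ι : Type} [Finite ι] (M : ι → ModuleCat.{u} R) (hM : ∀ i, 𝓠 (M i)) :
    𝓠 (directSum M) := by
  obtain ⟨n, ⟨e⟩⟩ := Finite.exists_equiv_fin ι
  exact h.of_linearEquiv (X := directSum fun i => M (e.symm i)) (Y := directSum M)
    (LinearEquiv.piCongrLeft R (fun i => M i) e.symm) (h.pi_fin _ fun i => hM _)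

theorem addClosure_le (h : ExtClosed 𝓠) (hr : RetractClosed 𝓠) (hM : 𝓠 M) (hX : addClosure M X) :
    𝓠 X := by
  obtain ⟨m, ⟨r⟩⟩ := hX
  exact hr r.i.hom r.r.hom (fun x => congrArg (fun t : X ⟶ X => t.hom x) r.retract)
    (h.pi _ fun _ => hM)

theorem of_star (h : ExtClosed 𝓠) {𝓧 𝓨 : ObjectProperty (ModuleCat.{u} R)}
    (hX : ∀ X, 𝓧 X → 𝓠 X) (hY : ∀ X, 𝓨 X → 𝓠 X) (hM : star 𝓧 𝓨 M) : 𝓠 M := by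
  obtain ⟨X, Y, f, g, w, hs, h₁, h₂⟩ := hM
  exact h.ext (f := f.hom) (g := g.hom)
    ⟨hs.moduleCat_injective_f,
      (ShortComplex.ShortExact.moduleCat_exact_iff_function_exact _).1 hs.exact,
      hs.moduleCat_surjective_g⟩ (hX _ h₁) (hY _ h₂)

/-- `F(Θ)` is contained in every class of modules that is closed under extensions and retracts and
contains `Θ`. -/
theorem filtFamily_le (h : ExtClosed 𝓠) (hr : RetractClosed 𝓠) {ι : Type} [Finite ι]
    {Θ : ι → ModuleCat.{u} R} (hM : ∀ i, 𝓠 (Θ i)) (hX : filtFamily Θ X) : 𝓠 X := by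
  obtain ⟨l, hl⟩ := hX
  have ha : ∀ X, addClosure (directSum Θ) X → 𝓠 X :=
    fun X hX => h.addClosure_le hr (h.pi _ hM) hX
  induction l generalizing X with
  | zero => exact ha _ hl
  | succ l ih => exact h.of_star ha (fun X hX => ih hX) hl

end ExtClosed

theorem star_of_isSES {𝓧 𝓨 : ObjectProperty (ModuleCat.{u} R)} {f : X →ₗ[R] M} {g : M →ₗ[R] Y}
    (h : IsSES f g) (hX : 𝓧 X) (hY : 𝓨 Y) : star 𝓧 𝓨 M :=
  ⟨X, Y, _, _, _, h.shortExact, hX, hY⟩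

theorem isSES_of_shortExact {f : X ⟶ M} {g : M ⟶ Y} {w : f ≫ g = 0}
    (hs : (ShortComplex.mk f g w).ShortExact) : IsSES f.hom g.hom :=
  ⟨hs.moduleCat_injective_f,
      (ShortComplex.ShortExact.moduleCat_exact_iff_function_exact _).1 hs.exact,
      hs.moduleCat_surjective_g⟩

/-- Products are nested to the right, so joining two filtrations needs associativity of `star`,
supplied by `exists_quotient`. Index a means a + 1 factors, so the a + b + 2 factors of the result
have index a + b + 1. -/
theorem starIter_ext {𝓧 : ObjectProperty (ModuleCat.{u} R)} {a b : ℕ} {f : X →ₗ[R] M}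
    {g : M →ₗ[R] Y} (h : IsSES f g) (hX : starIter 𝓧 a X) (hY : starIter 𝓧 b Y) :
    starIter 𝓧 (a + b + 1) M := by
  induction a generalizing X M with
  | zero => rw [zero_add]; exact star_of_isSES h hX hY
  | succ a ih =>
    obtain ⟨X₁, X₂, i, p, w, hs, h₁, h₂⟩ := hX
    obtain ⟨Q, q, f', g', hq, hf'⟩ := (isSES_of_shortExact hs).exists_quotient h
    rw [show a + 1 + b + 1 = (a + b + 1) + 1 by ring]
    exact star_of_isSES hq h₁ (ih hf' h₂)

theorem mem_addClosure {ι : Type} [Finite ι] (i : X →ₗ[R] (ι → M)) (r : (ι → M) →ₗ[R] X)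
    (hri : ∀ x, r (i x) = x) : addClosure M X := by
  obtain ⟨n, ⟨e⟩⟩ := Finite.exists_equiv_fin ι
  refine ⟨n, ⟨⟨ModuleCat.ofHom (((LinearEquiv.funCongrLeft R M e.symm).toLinearMap ∘ₗ i)),
    ModuleCat.ofHom (r ∘ₗ (LinearEquiv.funCongrLeft R M e).toLinearMap), ?_⟩⟩⟩
  ext x
  have : (LinearEquiv.funCongrLeft R M e) ((LinearEquiv.funCongrLeft R M e.symm) (i x)) = i x := by
    funext j; simp [LinearEquiv.funCongrLeft_apply, LinearMap.funLeft_apply]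
  change r (LinearEquiv.funCongrLeft R M e (LinearEquiv.funCongrLeft R M e.symm (i x))) = x
  rw [this, hri]

theorem addClosure_elim (h : addClosure M X) : ∃ (n : ℕ) (i : X →ₗ[R] (Fin n → M))
    (r : (Fin n → M) →ₗ[R] X), ∀ x, r (i x) = x := by
  obtain ⟨n, ⟨r⟩⟩ := h
  exact ⟨n, r.i.hom, r.r.hom, fun x => congrArg (fun t : X ⟶ X => t.hom x) r.retract⟩

theorem addClosure_of_subsingleton (h : Subsingleton X) : addClosure M X :=
  mem_addClosure (ι := Fin 0) 0 0 fun _ => Subsingleton.elim _ _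

theorem retractClosed_addClosure : RetractClosed (addClosure M) := by
  intro X Y i r hri hY
  obtain ⟨n, j, s, hs⟩ := addClosure_elim hY
  exact mem_addClosure (j ∘ₗ i) (r ∘ₗ s) fun x => by simp [hs, hri]

theorem extClosed_filtFamily {ι : Type} [Finite ι] (Θ : ι → ModuleCat.{u} R) :
    ExtClosed (filtFamily Θ) where
  zero _ h := ⟨0, addClosure_of_subsingleton h⟩
  ext h hX hZ := by
    obtain ⟨a, ha⟩ := hX
    obtain ⟨b, hb⟩ := hZ
    exact ⟨_, starIter_ext h ha hb⟩

theorem addClosure_le_filtFamily {ι : Type} [Finite ι] (Θ : ι → ModuleCat.{u} R) (j : ι)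
    (h : addClosure (Θ j) X) : filtFamily Θ X := by
  classical
  obtain ⟨n, i, r, hri⟩ := addClosure_elim h
  refine ⟨0, mem_addClosure (M := directSum Θ)
    ((LinearMap.single R (fun i => Θ i) j).compLeft (Fin n) ∘ₗ i)
    (r ∘ₗ (LinearMap.proj (φ := fun i => Θ i) j).compLeft (Fin n)) fun x => ?_⟩
  have : (LinearMap.proj (R := R) (φ := fun i => Θ i) j).compLeft (Fin n)
      ((LinearMap.single R (fun i => Θ i) j).compLeft (Fin n) (i x)) = i x := by
    funext k; simp
  change r ((LinearMap.proj (R := R) (φ := fun i => Θ i) j).compLeft (Fin n)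
      ((LinearMap.single R (fun i => Θ i) j).compLeft (Fin n) (i x))) = x
  rw [this, hri]

theorem addClosure_self : addClosure M M :=
  mem_addClosure (ι := Fin 1) (LinearMap.pi fun _ => LinearMap.id) (LinearMap.proj 0) fun _ => rfl

theorem filtFamily_self {ι : Type} [Finite ι] (Θ : ι → ModuleCat.{u} R) (j : ι) :
    filtFamily Θ (Θ j) :=
  addClosure_le_filtFamily Θ j addClosure_self

/-- The smallest class of modules containing `B` and closed under extensions and retracts. -/
inductive RClosure (B : ModuleCat.{u} R) : ModuleCat.{u} R → Prop
  | zero (X : ModuleCat.{u} R) : Subsingleton X → RClosure B X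
  | self : RClosure B B
  | ext {X Y Z : ModuleCat.{u} R} (f : X →ₗ[R] Y) (g : Y →ₗ[R] Z) :
    IsSES f g → RClosure B X → RClosure B Z → RClosure B Y
  | retract {X Y : ModuleCat.{u} R} (i : X →ₗ[R] Y) (r : Y →ₗ[R] X) :
    (∀ x, r (i x) = x) → RClosure B Y → RClosure B X

/-- The smallest class of modules containing `B` and closed under extensions. -/
inductive ExtClosure (B : ModuleCat.{u} R) : ModuleCat.{u} R → Prop
  | zero (X : ModuleCat.{u} R) : Subsingleton X → ExtClosure B X
  | self : ExtClosure B B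
  | ext {X Y Z : ModuleCat.{u} R} (f : X →ₗ[R] Y) (g : Y →ₗ[R] Z) :
    IsSES f g → ExtClosure B X → ExtClosure B Z → ExtClosure B Y

variable {B : ModuleCat.{u} R}

theorem extClosed_RClosure : ExtClosed (RClosure B) := ⟨.zero, fun h => .ext _ _ h⟩

theorem extClosed_ExtClosure : ExtClosed (ExtClosure B) := ⟨.zero, fun h => .ext _ _ h⟩

theorem RClosure.le {𝓠 : ObjectProperty (ModuleCat.{u} R)} (h : ExtClosed 𝓠)
    (hr : RetractClosed 𝓠) (hB : 𝓠 B) {X : ModuleCat.{u} R} (hX : RClosure B X) : 𝓠 X := by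
  induction hX with
  | zero X hX => exact h.zero X hX
  | self => exact hB
  | ext f g hs _ _ h₁ h₂ => exact h.ext hs h₁ h₂
  | retract i r hri _ ih => exact hr i r hri ih

theorem ExtClosure.le {𝓠 : ObjectProperty (ModuleCat.{u} R)} (h : ExtClosed 𝓠)
    (hB : 𝓠 B) {X : ModuleCat.{u} R} (hX : ExtClosure B X) : 𝓠 X := by
  induction hX with
  | zero X hX => exact h.zero X hX
  | self => exact hB
  | ext f g hs _ _ h₁ h₂ => exact h.ext hs h₁ h₂

theorem extClosed_extVanish_left (W : ModuleCat.{u} R) : ExtClosed (fun X : ModuleCat.{u} R => ExtVanish X W) :=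
  ⟨fun _ _ => .of_subsingleton_left, fun h h₁ h₂ => .of_ses_left h h₁ h₂⟩

theorem extClosed_extVanish_right (W : ModuleCat.{u} R) : ExtClosed (fun X : ModuleCat.{u} R => ExtVanish W X) :=
  ⟨fun _ _ => .of_subsingleton_right, fun h h₁ h₂ => .of_ses_right h h₁ h₂⟩

theorem retractClosed_extVanish_left (W : ModuleCat.{u} R) :
    RetractClosed (fun X : ModuleCat.{u} R => ExtVanish X W) :=
  fun _ _ i r h h' => .retract_left i r h h'

theorem retractClosed_extVanish_right (W : ModuleCat.{u} R) :
    RetractClosed (fun X : ModuleCat.{u} R => ExtVanish W X) :=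
  fun _ _ i r h h' => .retract_right i r h h'

theorem extClosed_hom_left (W : ModuleCat.{u} R) : ExtClosed (fun X : ModuleCat.{u} R => ∀ f : X →ₗ[R] W, f = 0) where
  zero X hX f := by ext x; rw [Subsingleton.elim x 0]; simp
  ext := by
    intro X Y Z f g h h₁ h₂ φ
    obtain ⟨ψ, hψ⟩ := h.exists_desc φ fun x => LinearMap.congr_fun (h₁ (φ ∘ₗ f)) x
    ext y
    rw [← hψ, h₂ ψ]; rfl

theorem extClosed_hom_right (W : ModuleCat.{u} R) :
    ExtClosed (fun X : ModuleCat.{u} R => ∀ f : W →ₗ[R] X, f = 0) where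
  zero X hX f := by ext x; exact Subsingleton.elim _ _
  ext := by
    intro X Y Z f g h h₁ h₂ φ
    obtain ⟨ψ, hψ⟩ := h.exists_lift φ fun x => LinearMap.congr_fun (h₂ (g ∘ₗ φ)) x
    ext y
    rw [← hψ, h₁ ψ]; simp

theorem retractClosed_hom_left (W : ModuleCat.{u} R) :
    RetractClosed (fun X : ModuleCat.{u} R => ∀ f : X →ₗ[R] W, f = 0) := by
  intro X Y i r hri h f
  ext x
  rw [← hri x]
  exact LinearMap.congr_fun (h (f ∘ₗ r)) _

theorem retractClosed_hom_right (W : ModuleCat.{u} R) :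
    RetractClosed (fun X : ModuleCat.{u} R => ∀ f : W →ₗ[R] X, f = 0) := by
  intro X Y i r hri h f
  ext x
  rw [← hri (f x), show i (f x) = 0 from LinearMap.congr_fun (h (i ∘ₗ f)) _, map_zero]; rfl

theorem extClosed_finite : ExtClosed (fun X : ModuleCat.{u} R => Module.Finite R X) where
  zero X hX := inferInstance
  ext := by
    intro X Y Z f g h h₁ h₂
    refine ⟨Submodule.fg_of_fg_map_of_fg_inf_ker g ?_ ?_⟩
    · rw [Submodule.map_top, LinearMap.range_eq_top.2 h.surj]; exact h₂.1
    · rw [top_inf_eq, LinearMap.exact_iff.1 h.exact, LinearMap.range_eq_map]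
      exact h₁.1.map f

theorem retractClosed_finite : RetractClosed (fun X : ModuleCat.{u} R => Module.Finite R X) := by
  intro X Y i r hri h
  exact Module.Finite.of_surjective r fun x => ⟨_, hri x⟩

/-- For a module without self-extensions, `add B` is closed under extensions. -/
theorem extClosed_addClosure (hB : ExtVanish B B) : ExtClosed (addClosure B) where
  zero _ h := addClosure_of_subsingleton h
  ext := by
    intro X Y Z f g h hX hZ
    -- Vanishing of Ext¹(B, B) passes to add B in both variables, so the sequence splits and Y is a
    -- retract of B^a ⊕ B^b.
    have hXB : ExtVanish B X := (extClosed_extVanish_right B).addClosure_le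
      (retractClosed_extVanish_right B) hB hX
    have hZX : ExtVanish Z X := (extClosed_extVanish_left X).addClosure_le
      (retractClosed_extVanish_left X) hXB hZ
    obtain ⟨s, hs⟩ := hZX.exists_lift h LinearMap.id
    obtain ⟨t, ht⟩ := hZX.exists_extend h LinearMap.id
    obtain ⟨a, i, r, hri⟩ := addClosure_elim hX
    obtain ⟨b, j, q, hqj⟩ := addClosure_elim hZ
    obtain ⟨s', hs'⟩ : ∃ s' : Y →ₗ[R] X, ∀ y, f (s' y) = y - s (g y) := by
      refine h.exists_lift (LinearMap.id - s ∘ₗ g) fun y => ?_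
      simp only [LinearMap.sub_apply, LinearMap.comp_apply, map_sub]
      rw [hs]; simp
    let e := LinearEquiv.sumArrowLequivProdArrow (Fin a) (Fin b) R B
    refine mem_addClosure (ι := Fin a ⊕ Fin b)
      (e.symm.toLinearMap ∘ₗ LinearMap.prod (i ∘ₗ s') (j ∘ₗ g))
      (LinearMap.coprod (f ∘ₗ r) (s ∘ₗ q) ∘ₗ e.toLinearMap) fun y => ?_
    simp only [LinearMap.comp_apply, LinearEquiv.coe_coe, LinearEquiv.apply_symm_apply,
      LinearMap.prod_apply, Function.prod, LinearMap.coprod_apply, hri, hqj]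
    rw [hs', sub_add_cancel]

/-- Bricks in terms of linear maps. -/
structure LinBrick (B : ModuleCat.{u} R) : Prop where
  nontrivial : Nontrivial B
  bijective : ∀ f : B →ₗ[R] B, f ≠ 0 → Function.Bijective f

/-- Induction along 0 → X → Y → Z → 0. If f vanishes on X, it factors through Z, and its kernel is
an extension of the kernel on Z by X. Otherwise f is already onto on X, and its kernel is an
extension of Z by the kernel on X. -/
theorem ExtClosure.ker_mem (hB : LinBrick B) {X : ModuleCat.{u} R} (hX : ExtClosure B X)
    (f : X →ₗ[R] B) (hf : f ≠ 0) :
    Function.Surjective f ∧ ExtClosure B (ModuleCat.of R (LinearMap.ker f)) := by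
  induction hX with
  | zero X hX => exact absurd (by ext x; rw [Subsingleton.elim x 0]; simp) hf
  | self =>
    have := hB.bijective f hf
    refine ⟨this.2, .zero _ ?_⟩
    rw [LinearMap.ker_eq_bot.2 this.1]
    exact inferInstanceAs (Subsingleton (⊥ : Submodule R B))
  | @ext X Y Z i p hs hX hZ h₁ h₂ =>
    by_cases h0 : f ∘ₗ i = 0
    · obtain ⟨ψ, hψ⟩ := hs.exists_desc f fun x => LinearMap.congr_fun h0 x
      have hψ0 : ψ ≠ 0 := by
        rintro rfl
        exact hf (by ext y; rw [← hψ]; rfl)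
      obtain ⟨h3, h4⟩ := h₂ ψ hψ0
      have hf' : f = ψ ∘ₗ p := by ext y; exact (hψ y).symm
      subst hf'
      obtain ⟨K, k, i', p', hk, hi'⟩ := hs.exists_comp (IsSES.ker_subtype h3)
      refine ⟨h3.comp hs.surj, ?_⟩
      have hK : ExtClosure B K := .ext i' p' hi' hX h4
      refine extClosed_ExtClosure.of_linearEquiv ((LinearEquiv.ofInjective k hk.inj).trans
        (LinearEquiv.ofEq _ _ (LinearMap.exact_iff.1 hk.exact).symm)) hK
    · obtain ⟨h3, h4⟩ := h₁ _ h0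
      have h5 : Function.Surjective f := Function.Surjective.of_comp h3
      refine ⟨h5, ?_⟩
      refine .ext (X := ModuleCat.of R (LinearMap.ker (f ∘ₗ i)))
        (i.restrict (p := LinearMap.ker (f ∘ₗ i)) (q := LinearMap.ker f) fun x hx => hx)
        (p ∘ₗ (LinearMap.ker f).subtype) ⟨?_, ?_, ?_⟩ h4 hZ
      · intro x y hxy
        exact Subtype.ext (hs.inj (congrArg Subtype.val hxy))
      · rintro ⟨y, hy⟩
        constructor
        · intro hy'
          obtain ⟨x, rfl⟩ := (hs.exact _).1 hy'
          exact ⟨⟨x, hy⟩, rfl⟩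
        · rintro ⟨x, hx⟩
          rw [← hx]
          exact hs.comp_apply _
      · intro z
        obtain ⟨y, rfl⟩ := hs.surj z
        obtain ⟨x, hx⟩ := h3 (f y)
        refine ⟨⟨y - i x, ?_⟩, ?_⟩
        · simpa [sub_eq_zero] using hx.symm
        · simp [hs.comp_apply]

theorem ExtClosure.exists_ne_zero [Nontrivial B] {X : ModuleCat.{u} R}
    (hX : ExtClosure B X) (h : Nontrivial X) : ∃ f : X →ₗ[R] B, f ≠ 0 := by
  induction hX with
  | zero X hX => exact absurd hX (not_subsingleton_iff_nontrivial.2 h)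
  | self => exact ⟨LinearMap.id, fun h0 => by
      obtain ⟨x, hx⟩ := exists_ne (0 : B)
      exact hx (LinearMap.congr_fun h0 x)⟩
  | @ext X Y Z i p hs hX hZ h₁ h₂ =>
    rcases subsingleton_or_nontrivial Z with hZ' | hZ'
    · have hi : Function.Surjective i := fun y => (hs.exact y).1 (Subsingleton.elim _ _)
      have hX' : Nontrivial X := hi.nontrivial
      obtain ⟨f, hf⟩ := h₁ hX'
      refine ⟨f ∘ₗ (LinearEquiv.ofBijective i ⟨hs.inj, hi⟩).symm.toLinearMap, fun h0 => hf ?_⟩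
      ext x
      have := LinearMap.congr_fun h0 (i x)
      have h6 : (LinearEquiv.ofBijective i ⟨hs.inj, hi⟩).symm (i x) = x := by
        rw [LinearEquiv.symm_apply_eq]; rfl
      simpa [h6] using this
    · obtain ⟨f, hf⟩ := h₂ hZ'
      refine ⟨f ∘ₗ p, fun h0 => hf ?_⟩
      ext z
      obtain ⟨y, rfl⟩ := hs.surj z
      exact LinearMap.congr_fun h0 y

variable [IsArtinianRing R]

/-- Induction on the length of Y, which drops on passing to the kernel of a nonzero map Y → B; such
kernels stay in the class by `ExtClosure.ker_mem`. -/
theorem retractClosed_ExtClosure (hB : LinBrick B) [Module.Finite R B] :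
    RetractClosed (ExtClosure B) := by
  have key : ∀ (n : ℕ) (X Y : ModuleCat.{u} R) (i : X →ₗ[R] Y) (r : Y →ₗ[R] X),
      (∀ x, r (i x) = x) → ExtClosure B Y → Module.length R Y ≤ n → ExtClosure B X := by
    intro n
    induction n with
    | zero =>
      intro X Y i r hri hY hn
      have hY0 : Subsingleton Y := Module.length_eq_zero_iff.1 (le_antisymm hn bot_le)
      exact .zero _ (Function.Surjective.subsingleton (f := r) fun x => ⟨_, hri x⟩)
    | succ n ih =>
      intro X Y i r hri hY hn
      rcases subsingleton_or_nontrivial Y with hY0 | hY0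
      · exact .zero _ (Function.Surjective.subsingleton (f := r) fun x => ⟨_, hri x⟩)
      have : Module.Finite R Y := ExtClosure.le extClosed_finite ‹Module.Finite R B› hY
      have hlt : ∀ f : Y →ₗ[R] B, f ≠ 0 → Module.length R (LinearMap.ker f) ≤ n := by
        intro f hf
        have h1 : LinearMap.ker f ≠ ⊤ := fun h => hf (LinearMap.ker_eq_top.1 h)
        have h2 := (Submodule.length_lt h1).trans_le hn
        exact Order.le_of_lt_add_one (by simpa using h2)
      have := hB.nontrivial
      obtain ⟨f, hf⟩ := hY.exists_ne_zero hY0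
      by_cases h0 : f ∘ₗ i = 0
      · refine ih X (ModuleCat.of R (LinearMap.ker f))
          (i.codRestrict _ fun x => LinearMap.congr_fun h0 x)
          (r ∘ₗ (LinearMap.ker f).subtype) (fun x => hri x) (hY.ker_mem hB f hf).2 (hlt f hf)
      -- Replacing f by f ∘ i ∘ r makes i and r restrict to the kernels. Then the kernel of f ∘ i is
      -- in the class by induction, and X is an extension of B by it.
      · have hne : (f ∘ₗ i) ∘ₗ r ≠ 0 := by
          intro h
          apply h0
          ext x
          have := LinearMap.congr_fun h (i x)
          simpa [hri] using this
        obtain ⟨h1, h2⟩ := hY.ker_mem hB _ hne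
        have h3 : ExtClosure B (ModuleCat.of R (LinearMap.ker (f ∘ₗ i))) := by
          refine ih _ (ModuleCat.of R (LinearMap.ker ((f ∘ₗ i) ∘ₗ r)))
            (i.restrict fun x hx => ?_) (r.restrict fun x hx => hx) ?_ h2 (hlt _ hne)
          · simpa [hri] using hx
          · intro x
            exact Subtype.ext (hri x)
        have h4 : Function.Surjective (f ∘ₗ i) := Function.Surjective.of_comp h1
        exact .ext _ _ (IsSES.ker_subtype h4) h3 .self
  intro X Y i r hri hY
  have : Module.Finite R Y := ExtClosure.le extClosed_finite ‹Module.Finite R B› hY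
  obtain ⟨n, hn⟩ := ENat.ne_top_iff_exists.1 (Module.length_ne_top (R := R) (M := Y))
  exact key n X Y i r hri hY hn.ge

/-- For bricks and for modules without self-extensions, closing under extensions and retracts stays
inside `F(Θ)`. -/
theorem RClosure.filtFamily {ι : Type} [Finite ι] (Θ : ι → ModuleCat.{u} R) (j : ι)
    [Module.Finite R (Θ j)] (hj : LinBrick (Θ j) ∨ ExtVanish (Θ j) (Θ j))
    (hX : RClosure (Θ j) X) : filtFamily Θ X := by
  rcases hj with hj | hj
  · exact (hX.le extClosed_ExtClosure (retractClosed_ExtClosure hj) .self).le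
      (extClosed_filtFamily Θ) (filtFamily_self Θ j)
  · exact addClosure_le_filtFamily Θ j
      (hX.le (extClosed_addClosure hj) retractClosed_addClosure addClosure_self)

end Closure

/-! ### Finite generation of Hom spaces over the base field -/

section Approximation

variable {R : Type u} [Ring R]

/-- There is a bound `m` for the number of maps `K → N` needed to generate `Hom(K, N)`, uniform over
all modules `K` with a map `L → K` such that restriction from `K` to `L` is injective. -/
theorem exists_left_approximation (𝕜 : Type v) [Field 𝕜] [Algebra 𝕜 R]
    [FiniteDimensional 𝕜 R] (L N : ModuleCat.{u} R) [Module.Finite R L] [Module.Finite R N] :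
    ∃ m : ℕ, ∀ (K : ModuleCat.{u} R) (ω : L →ₗ[R] K), (∀ f : K →ₗ[R] N, f ∘ₗ ω = 0 → f = 0) →
      ∃ H : K →ₗ[R] (Fin m → N), ∀ f : K →ₗ[R] N, ∃ g : (Fin m → N) →ₗ[R] N, f = g ∘ₗ H := by
  let _ : Module 𝕜 N := Module.compHom N (algebraMap 𝕜 R)
  let _ : Module 𝕜 L := Module.compHom L (algebraMap 𝕜 R)
  have hN : ∀ (a : 𝕜) (x : N), a • x = algebraMap 𝕜 R a • x := fun _ _ => rfl
  have hL : ∀ (a : 𝕜) (x : L), a • x = algebraMap 𝕜 R a • x := fun _ _ => rfl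
  have : IsScalarTower 𝕜 R N := ⟨fun a r n => by rw [hN, Algebra.smul_def, mul_smul]⟩
  have : IsScalarTower 𝕜 R L := ⟨fun a r n => by rw [hL, Algebra.smul_def, mul_smul]⟩
  have : SMulCommClass R 𝕜 N := ⟨fun r a n => by
    rw [hN, hN, ← mul_smul, ← mul_smul, Algebra.commutes]⟩
  have : Module.Finite 𝕜 N := Module.Finite.trans R N
  have : Module.Finite 𝕜 L := Module.Finite.trans R L
  have : Module.Finite 𝕜 (L →ₗ[R] N) :=
    Module.Finite.of_injective (LinearMap.restrictScalarsₗ 𝕜 R L N 𝕜)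
      (LinearMap.restrictScalars_injective 𝕜)
  refine ⟨Module.finrank 𝕜 (L →ₗ[R] N), fun K ω hω => ?_⟩
  let res : (K →ₗ[R] N) →ₗ[𝕜] (L →ₗ[R] N) :=
    { toFun := fun f => f ∘ₗ ω
      map_add' := fun _ _ => rfl
      map_smul' := fun _ _ => rfl }
  have hres : Function.Injective res := (injective_iff_map_eq_zero _).2 hω
  have : Module.Finite 𝕜 (K →ₗ[R] N) := Module.Finite.of_injective res hres
  have hle := LinearMap.finrank_le_finrank_of_injective hres
  let b := Module.finBasis 𝕜 (K →ₗ[R] N)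
  -- Restriction along ω embeds Hom(K, N) in Hom(L, N), so a basis has at most m members; it is
  -- padded with zeros to length m, which does not depend on K.
  refine ⟨LinearMap.pi fun i => if h : i.1 < Module.finrank 𝕜 (K →ₗ[R] N) then b ⟨i, h⟩ else 0,
    fun f => ⟨∑ i, b.repr f i • LinearMap.proj (Fin.castLE hle i), ?_⟩⟩
  ext x
  have h := LinearMap.congr_fun (b.sum_repr f) x
  rw [LinearMap.sum_apply] at h
  rw [← h]
  simp

/-- H is assembled from a 𝕜-basis of Hom(M, N). The coefficients are kept as central elements of R,
because they will also have to act on a module other than M. -/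
theorem exists_right_approximation (𝕜 : Type v) [Field 𝕜] [Algebra 𝕜 R]
    [FiniteDimensional 𝕜 R] (M N : ModuleCat.{u} R) [Module.Finite R M]
    [Module.Finite R N] :
    ∃ (m : ℕ) (H : (Fin m → M) →ₗ[R] N), ∀ f : M →ₗ[R] N, ∃ c : Fin m → R,
      (∀ i r, c i * r = r * c i) ∧ ∀ x, f x = H fun i => c i • x := by
  let _ : Module 𝕜 N := Module.compHom N (algebraMap 𝕜 R)
  let _ : Module 𝕜 M := Module.compHom M (algebraMap 𝕜 R)
  have hN : ∀ (a : 𝕜) (x : N), a • x = algebraMap 𝕜 R a • x := fun _ _ => rfl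
  have hM : ∀ (a : 𝕜) (x : M), a • x = algebraMap 𝕜 R a • x := fun _ _ => rfl
  have : IsScalarTower 𝕜 R N := ⟨fun a r n => by rw [hN, Algebra.smul_def, mul_smul]⟩
  have : IsScalarTower 𝕜 R M := ⟨fun a r n => by rw [hM, Algebra.smul_def, mul_smul]⟩
  have : SMulCommClass R 𝕜 N := ⟨fun r a n => by
    rw [hN, hN, ← mul_smul, ← mul_smul, Algebra.commutes]⟩
  have : SMulCommClass R 𝕜 M := ⟨fun r a n => by
    rw [hM, hM, ← mul_smul, ← mul_smul, Algebra.commutes]⟩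
  have : Module.Finite 𝕜 N := Module.Finite.trans R N
  have : Module.Finite 𝕜 M := Module.Finite.trans R M
  have : Module.Finite 𝕜 (M →ₗ[R] N) :=
    Module.Finite.of_injective (LinearMap.restrictScalarsₗ 𝕜 R M N 𝕜)
      (LinearMap.restrictScalars_injective 𝕜)
  let b := Module.finBasis 𝕜 (M →ₗ[R] N)
  refine ⟨_, ∑ i, b i ∘ₗ LinearMap.proj i, fun f =>
    ⟨fun i => algebraMap 𝕜 R (b.repr f i), fun i r => Algebra.commutes _ _, fun x => ?_⟩⟩
  have h := LinearMap.congr_fun (b.sum_repr f) x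
  rw [LinearMap.sum_apply] at h
  rw [← h]
  simp only [LinearMap.sum_apply, LinearMap.smul_apply, LinearMap.comp_apply, LinearMap.proj_apply,
    map_smul]
  rfl

end Approximation

/-! ### Pushouts, universal extensions and coextensions -/

section Pushout

variable {R : Type u} [Ring R] {X Y Z M N W : ModuleCat.{u} R}

/-- The pushout of a short exact sequence `Ω → Q → E` along `h : Ω → B`. -/
theorem IsSES.exists_pushout {Ω Q E B : ModuleCat.{u} R} {i : Ω →ₗ[R] Q} {p : Q →ₗ[R] E}
    (hs : IsSES i p) (h : Ω →ₗ[R] B) :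
    ∃ (E' : ModuleCat.{u} R) (f : B →ₗ[R] E') (g : E' →ₗ[R] E) (q : Q →ₗ[R] E'),
      IsSES f g ∧ (∀ x, q (i x) = f (h x)) ∧
      ∃ r : (ModuleCat.of R (Q × B)) →ₗ[R] E', IsSES
        (Y := ModuleCat.of R (Q × B)) (i.prod (-h)) r := by
  -- The pushout is the cokernel of x ↦ (i x, -h x). This second sequence is returned as well, since
  -- it reduces Ext¹ out of E' to extending maps from Ω to Q × B.
  have hu : IsSES (Y := ModuleCat.of R (Q × B))
      (Z := ModuleCat.of R ((Q × B) ⧸ LinearMap.range (i.prod (-h)))) (i.prod (-h)) _ :=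
    IsSES.mkQ_range (fun x y hxy => hs.inj (congrArg Prod.fst hxy))
  let r : (ModuleCat.of R (Q × B)) →ₗ[R]
    ModuleCat.of R ((Q × B) ⧸ LinearMap.range (i.prod (-h))) :=
      (LinearMap.range (i.prod (-h))).mkQ
  have hr : ∀ x, r (i x, 0) = r (0, h x) := by
    intro x
    rw [← sub_eq_zero, ← map_sub]
    have : ((i x, 0) - (0, h x) : ModuleCat.of R (Q × B)) = i.prod (-h) x := by
      ext <;> simp
    rw [this]
    exact hu.comp_apply x
  obtain ⟨g, hg⟩ := hu.exists_desc (p ∘ₗ LinearMap.fst R Q B :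
    ModuleCat.of R (Q × B) →ₗ[R] E) (fun x => hs.comp_apply x)
  have hg' : ∀ a b, g (r (a, b)) = p a := fun a b => hg (a, b)
  refine ⟨_, r ∘ₗ LinearMap.inr R Q B, g, r ∘ₗ LinearMap.inl R Q B, ⟨?_, ?_, ?_⟩, ?_, _, hu⟩
  · rw [injective_iff_map_eq_zero]
    intro b hb
    obtain ⟨x, hx⟩ := (hu.exact _).1 hb
    have h1 : i x = 0 := congrArg Prod.fst hx
    have h2 : (-h) x = b := congrArg Prod.snd hx
    rw [← h2, (injective_iff_map_eq_zero _).1 hs.inj x h1, map_zero]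
  · intro e
    obtain ⟨⟨a, b⟩, rfl⟩ := hu.surj e
    change g (r (a, b)) = 0 ↔ _
    rw [hg']
    constructor
    · intro ha
      obtain ⟨x, rfl⟩ := (hs.exact _).1 ha
      refine ⟨h x + b, ?_⟩
      change r (0, h x + b) = r (i x, b)
      have h1 : ((0, h x + b) : ModuleCat.of R (Q × B)) = (0, h x) + (0, b) := by
        ext <;> simp
      have h2 : ((i x, b) : ModuleCat.of R (Q × B)) = (i x, 0) + (0, b) := by
        ext <;> simp
      rw [h1, h2, map_add, map_add, hr]
    · rintro ⟨b', hb'⟩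
      rw [← hg' a b]
      change _ = r (a, b) at hb'
      rw [← hb']
      change g (r (0, b')) = 0
      rw [hg', map_zero]
  · intro e
    obtain ⟨a, rfl⟩ := hs.surj e
    exact ⟨r (a, 0), hg' a 0⟩
  · intro x; exact hr x

/-- A finitely generated module over a Noetherian ring has a presentation by a finitely generated
projective module. -/
theorem exists_presentation [IsNoetherianRing R] (E : ModuleCat.{u} R) [Module.Finite R E] :
    ∃ (Ω Q : ModuleCat.{u} R) (i : Ω →ₗ[R] Q) (p : Q →ₗ[R] E), IsSES i p ∧ Module.Finite R Ω ∧
      Module.Finite R Q ∧ Module.Projective R Q := by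
  obtain ⟨n, p, hp⟩ := Module.Finite.exists_fin' R E
  exact ⟨_, ModuleCat.of R (Fin n → R), _, p, IsSES.ker_subtype hp,
    inferInstanceAs (Module.Finite R (LinearMap.ker p)),
    inferInstanceAs (Module.Finite R (Fin n → R)),
    inferInstanceAs (Module.Projective R (Fin n → R))⟩

/-- If every extension of `E` by `B` splits, then `Ext¹(E, B) = 0`. -/
theorem ExtVanish.of_splits [IsNoetherianRing R] {E B : ModuleCat.{u} R} [Module.Finite R E]
    (h : ∀ (E' : ModuleCat.{u} R) (f : B →ₗ[R] E') (g : E' →ₗ[R] E), IsSES f g →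
      ∃ r : E' →ₗ[R] B, ∀ x, r (f x) = x) : ExtVanish E B := by
  obtain ⟨Ω, Q, i, p, hs, -, -, hQ⟩ := exists_presentation E
  refine .of_extends hs .of_projective fun φ => ?_
  obtain ⟨E', f, g, q, hfg, hq, -⟩ := hs.exists_pushout φ
  obtain ⟨r, hr⟩ := h E' f g hfg
  exact ⟨r ∘ₗ q, fun x => by simp [hq, hr]⟩

/-- The universal extension `B^m → E' → E`. -/
theorem exists_universal_extension (𝕜 : Type v) [Field 𝕜] [Algebra 𝕜 R]
    [FiniteDimensional 𝕜 R] [IsNoetherianRing R] {E B : ModuleCat.{u} R} [Module.Finite R E]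
    [Module.Finite R B] (hB : ExtVanish B B) :
    ∃ (K E' : ModuleCat.{u} R) (f : K →ₗ[R] E') (g : E' →ₗ[R] E), IsSES f g ∧ RClosure B K ∧
      ExtVanish E' B := by
  obtain ⟨Ω, Q, i, p, hs, hΩ, -, hQ⟩ := exists_presentation E
  obtain ⟨m, hm⟩ := exists_left_approximation 𝕜 Ω B
  obtain ⟨H, hH⟩ := hm Ω LinearMap.id fun f hf => hf
  have hK : RClosure B (ModuleCat.of R (Fin m → B)) := extClosed_RClosure.pi_fin _ fun _ => .self
  obtain ⟨E', f, g, q, hfg, -, r, hr⟩ :=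
    hs.exists_pushout (B := ModuleCat.of R (Fin m → B)) H
  refine ⟨_, E', f, g, hfg, hK, .of_extends hr ?_ fun φ => ?_⟩
  · exact .of_ses_left IsSES.prod .of_projective
      (hK.le (extClosed_extVanish_left B) (retractClosed_extVanish_left B) hB)
  -- The second component of Ω → Q × B^m is -H, so -c on that factor extends c ∘ H.
  · obtain ⟨c, rfl⟩ := hH φ
    refine ⟨-(c ∘ₗ LinearMap.snd R Q (Fin m → B)), fun x => ?_⟩
    simp

/-- The universal coextension `E → E' → B^m`. -/
theorem exists_universal_coextension (𝕜 : Type v) [Field 𝕜] [Algebra 𝕜 R]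
    [FiniteDimensional 𝕜 R] [IsNoetherianRing R] {E B : ModuleCat.{u} R}
    [Module.Finite R E] [Module.Finite R B] (hB : ExtVanish B B) :
    ∃ (K E' : ModuleCat.{u} R) (f : E →ₗ[R] E') (g : E' →ₗ[R] K), IsSES f g ∧ RClosure B K ∧
      ExtVanish B E' := by
  obtain ⟨Ω, Q, i, p, hs, hΩ, -, hQ⟩ := exists_presentation B
  obtain ⟨m, H, hH⟩ := exists_right_approximation 𝕜 Ω E
  have hK : RClosure B (ModuleCat.of R (Fin m → B)) := extClosed_RClosure.pi_fin _ fun _ => .self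
  have hpow : IsSES (X := ModuleCat.of R (Fin m → Ω)) (Y := ModuleCat.of R (Fin m → Q))
      (Z := ModuleCat.of R (Fin m → B)) (i.compLeft (Fin m)) (p.compLeft (Fin m)) := by
    refine ⟨fun x y hxy => funext fun j => hs.inj (congrFun hxy j), fun y => ?_, fun z => ?_⟩
    · constructor
      · intro hy
        choose x hx using fun j => (hs.exact (y j)).1 (congrFun hy j)
        exact ⟨x, funext hx⟩
      · rintro ⟨x, rfl⟩
        exact funext fun j => hs.comp_apply (x j)
    · choose y hy using fun j => hs.surj (z j)
      exact ⟨y, funext hy⟩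
  -- The coextension is the pushout of the presentation Ω^m → Q^m → B^m along H : Ω^m → E, so no
  -- injective modules are needed.
  obtain ⟨E', f, g, q, hfg, hq, -⟩ := hpow.exists_pushout (B := E) H
  refine ⟨_, E', f, g, hfg, hK, .of_extends hs .of_projective fun φ => ?_⟩
  have hBK : ExtVanish B (ModuleCat.of R (Fin m → B)) :=
    hK.le (extClosed_extVanish_right B) (retractClosed_extVanish_right B) hB
  -- To extend φ : Ω → E' to Q: g ∘ φ extends because Ext¹(B, B^m) = 0, and the extension lifts to
  -- E' because Q is projective. The remaining error χ takes values in E.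
  obtain ⟨ψ, hψ⟩ := hBK.exists_extend hs (g ∘ₗ φ)
  obtain ⟨ψ', hψ'⟩ := (ExtVanish.of_projective (X := Q)).exists_lift hfg ψ
  obtain ⟨χ, hχ⟩ := hfg.exists_lift (φ - ψ' ∘ₗ i) fun x => by
    simp [hψ', hψ]
  obtain ⟨c, hc, hcχ⟩ := hH χ
  -- The coefficients expressing χ through H also act on Q, being central, and q ∘ d extends f ∘ χ
  -- by the pushout square.
  let d : Q →ₗ[R] (Fin m → Q) :=
    { toFun := fun y j => c j • y
      map_add' := fun _ _ => funext fun _ => smul_add _ _ _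
      map_smul' := fun r y => funext fun j => by simp [← mul_smul, hc] }
  refine ⟨ψ' + q ∘ₗ d, fun x => ?_⟩
  have h1 : d (i x) = i.compLeft (Fin m) fun j => c j • x := funext fun j => (map_smul i _ _).symm
  have h2 := hχ x
  rw [hcχ, ← hq] at h2
  rw [LinearMap.add_apply, LinearMap.comp_apply, h1]
  rw [h2]
  simp

end Pushout

/-! ### Extensions by a brick: termination -/

section BrickExtension

/-- Factoring out the cyclic submodule of a nonzero element lowers the length by at least one and
costs one generator. -/
theorem exists_surjective_of_length_le {R : Type u} [Ring R] (l : ℕ) :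
    ∀ (M : Type u) [AddCommGroup M] [Module R M], Module.length R M ≤ l →
      ∃ s : (Fin l → R) →ₗ[R] M, Function.Surjective s := by
  induction l with
  | zero =>
    intro M _ _ h
    have : Subsingleton M := Module.length_eq_zero_iff.1 (le_antisymm h bot_le)
    exact ⟨0, fun x => ⟨0, Subsingleton.elim _ _⟩⟩
  | succ l ih =>
    intro M _ _ h
    rcases subsingleton_or_nontrivial M with hM | hM
    · exact ⟨0, fun x => ⟨0, Subsingleton.elim _ _⟩⟩
    obtain ⟨x, hx⟩ := exists_ne (0 : M)
    let N := Submodule.span R {x}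
    have hN : Nontrivial N := (Submodule.nontrivial_iff_ne_bot).2 (by simpa [N] using hx)
    have h1 := Module.length_eq_add_of_exact N.subtype N.mkQ N.injective_subtype
      N.mkQ_surjective (LinearMap.exact_subtype_mkQ N)
    have h2 : 1 ≤ Module.length R N := Order.one_le_iff_pos.2 Module.length_pos
    have h3 : Module.length R (M ⧸ N) ≤ l := by
      have h4 : 1 + Module.length R (M ⧸ N) ≤ 1 + l := by
        calc 1 + Module.length R (M ⧸ N) ≤ Module.length R N + Module.length R (M ⧸ N) := by gcongr
          _ = Module.length R M := h1.symm
          _ ≤ _ := h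
          _ = 1 + l := by push_cast; rw [add_comm]
      exact (ENat.add_le_add_iff_left (by simp)).1 h4
    obtain ⟨s, hs⟩ := ih (M ⧸ N) h3
    obtain ⟨s', hs'⟩ := Module.projective_lifting_property N.mkQ s N.mkQ_surjective
    refine ⟨LinearMap.toSpanSingleton R M x ∘ₗ LinearMap.proj 0 +
      s' ∘ₗ LinearMap.funLeft R R Fin.succ, fun y => ?_⟩
    obtain ⟨v, hv⟩ := hs (N.mkQ y)
    rw [← hs', LinearMap.comp_apply, ← sub_eq_zero, ← map_sub] at hv
    have hy : s' v - y ∈ N := by rwa [← Submodule.ker_mkQ N, LinearMap.mem_ker]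
    obtain ⟨a, ha⟩ := Submodule.mem_span_singleton.1 hy
    refine ⟨Fin.cons (α := fun _ => R) (-a) v, ?_⟩
    have h5 : LinearMap.funLeft R R Fin.succ (Fin.cons (α := fun _ => R) (-a) v) = v := rfl
    simp only [LinearMap.add_apply, LinearMap.comp_apply, h5, LinearMap.proj_apply, Fin.cons_zero,
      LinearMap.toSpanSingleton_apply, neg_smul, ha]
    abel

variable {R : Type u} [Ring R]

/-- For a brick `B` such that every maximal submodule of an iterated self-extension `K` of `B`
contains the kernel of a map `K → B`, every module `E` has an extension `E'` by an iterated
self-extension of `B` with `Ext¹(E', B) = 0`. -/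
theorem exists_brick_extension (𝕜 : Type v) [Field 𝕜] [Algebra 𝕜 R] [FiniteDimensional 𝕜 R]
    [IsArtinianRing R] {E B : ModuleCat.{u} R} [Module.Finite R E]
    [Module.Finite R B] (hB : LinBrick B)
    (hmax : ∀ K, RClosure B K → ∀ M : Submodule R K, IsCoatom M →
      ∃ f : K →ₗ[R] B, LinearMap.ker f ≤ M) :
    ∃ (K E' : ModuleCat.{u} R) (f : K →ₗ[R] E') (g : E' →ₗ[R] E), IsSES f g ∧ RClosure B K ∧
      ExtVanish E' B := by
  obtain ⟨Ω, Q, i, p, hs, hΩ, -, hQ⟩ := exists_presentation E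
  obtain ⟨m, hm⟩ := exists_left_approximation 𝕜 Ω B
  have hBnt := hB.nontrivial
  obtain ⟨l, hl⟩ := ENat.ne_top_iff_exists.1
    (Module.length_ne_top (R := R) (M := ModuleCat.of R (Fin m → B)))
  obtain ⟨c, hc⟩ := ENat.ne_top_iff_exists.1 (Module.length_ne_top (R := R) (M := Fin l → R))
  -- As long as no nonzero map K → B extends to E', the length of K is bounded by a constant
  -- depending only on E and B. The number m bounds how many maps generate Hom(K, B), l is the
  -- length of B^m, and c is the length of R^l.
  have bound : ∀ (K E' : ModuleCat.{u} R) (f : K →ₗ[R] E') (g : E' →ₗ[R] E), IsSES f g →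
      RClosure B K → (∀ h : E' →ₗ[R] B, h ∘ₗ f = 0) → Module.length R K ≤ c := by
    intro K E' f g hfg hK hh
    have hKfin : Module.Finite R K := hK.le extClosed_finite retractClosed_finite ‹_›
    obtain ⟨π, hπ⟩ := (ExtVanish.of_projective (X := Q)).exists_lift hfg p
    obtain ⟨ω, hω⟩ := hfg.exists_lift (π ∘ₗ i) fun x => by simp [hπ, hs.comp_apply]
    -- E' is the quotient of Q × K by the relations (i w, -ω w). A map u with u ∘ ω = 0 respects
    -- them, so it extends to E' and must vanish.
    have hinj : ∀ u : K →ₗ[R] B, u ∘ₗ ω = 0 → u = 0 := by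
      intro u hu
      let σ : ModuleCat.of R (Q × K) →ₗ[R] E' := LinearMap.coprod π f
      have hσ : Function.Surjective σ := by
        intro e
        obtain ⟨a, ha⟩ := hs.surj (g e)
        obtain ⟨k, hk⟩ := (hfg.exact (e - π a)).1 (by rw [map_sub, hπ, ha, sub_self])
        exact ⟨(a, k), by simp [σ, hk]⟩
      obtain ⟨h, hh'⟩ := (IsSES.ker_subtype hσ).exists_desc
        (u ∘ₗ LinearMap.snd R Q K : ModuleCat.of R (Q × K) →ₗ[R] B) (by
          rintro ⟨⟨a, k⟩, hak⟩
          have hak' : π a + f k = 0 := by simpa [σ] using hak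
          have hpa : p a = 0 := by
            rw [← hπ, eq_neg_of_add_eq_zero_left hak', map_neg, hfg.comp_apply, neg_zero]
          obtain ⟨w, rfl⟩ := (hs.exact a).1 hpa
          have : k = -ω w := by
            apply hfg.inj
            rw [map_neg, hω]
            exact eq_neg_of_add_eq_zero_right hak'
          have h0 : u (ω w) = 0 := LinearMap.congr_fun hu w
          change u k = 0
          rw [this, map_neg, h0, neg_zero])
      ext k
      have h1 := hh' (0, k)
      have h2 : σ (0, k) = f k := by simp [σ]
      rw [h2] at h1
      exact h1.symm.trans (LinearMap.congr_fun (hh h) k)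
    obtain ⟨H, hH⟩ := hm K ω hinj
    have h3 : Module.length R (K ⧸ LinearMap.ker H) ≤ l := by
      rw [hl]
      exact Module.length_le_of_injective ((LinearMap.ker H).liftQ H le_rfl)
        (LinearMap.ker_eq_bot.1 (Submodule.ker_liftQ_eq_bot _ _ _ le_rfl))
    obtain ⟨s, hs⟩ := exists_surjective_of_length_le l _ h3
    obtain ⟨s', hs'⟩ := Module.projective_lifting_property (LinearMap.ker H).mkQ s
      (Submodule.mkQ_surjective _)
    -- A Nakayama argument: a maximal submodule M containing the range of s' contains the kernel of
    -- some K → B, and this map factors through H. So M contains ker H too, although s' is onto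
    -- modulo ker H.
    have htop : LinearMap.range s' = ⊤ := by
      by_contra hne
      obtain ⟨M, hM, hle⟩ := (eq_top_or_exists_le_coatom (LinearMap.range s')).resolve_left hne
      obtain ⟨φ, hφ⟩ := hmax K hK M hM
      obtain ⟨ψ, rfl⟩ := hH φ
      have hHM : LinearMap.ker H ≤ M := le_trans (fun x hx => by
        simp [LinearMap.mem_ker.1 hx]) hφ
      refine hM.1 (eq_top_iff.2 fun x _ => ?_)
      obtain ⟨v, hv⟩ := hs ((LinearMap.ker H).mkQ x)
      rw [← hs', LinearMap.comp_apply, ← sub_eq_zero, ← map_sub] at hv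
      have hx : s' v - x ∈ LinearMap.ker H := by
        rwa [← Submodule.ker_mkQ (LinearMap.ker H), LinearMap.mem_ker]
      have := M.sub_mem (hle ⟨v, rfl⟩) (hHM hx)
      simpa using this
    rw [hc]
    exact Module.length_le_of_surjective s' (LinearMap.range_eq_top.1 htop)
  by_contra hcon
  -- If no extension achieves Ext¹(E', B) = 0, a nonsplit extension by B is always available, and K
  -- grows without bound while maps E' → B keep vanishing on K.
  have key : ∀ n : ℕ, ∃ (K E' : ModuleCat.{u} R) (f : K →ₗ[R] E') (g : E' →ₗ[R] E), IsSES f g ∧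
      RClosure B K ∧ (∀ h : E' →ₗ[R] B, h ∘ₗ f = 0) ∧ n ≤ Module.length R K := by
    intro n
    induction n with
    | zero =>
      refine ⟨ModuleCat.of R PUnit, E, 0, LinearMap.id, ⟨fun _ _ _ => Subsingleton.elim _ _,
        fun y => ⟨fun h => ⟨0, h.symm⟩, fun ⟨x, hx⟩ => hx.symm⟩, Function.surjective_id⟩,
        .zero _ inferInstance, fun h => by simp, by simp⟩
    | succ n ih =>
      obtain ⟨K, E', f, g, hfg, hK, hh, hn⟩ := ih
      have hE' : Module.Finite R E' := extClosed_finite.ext hfg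
        (hK.le extClosed_finite retractClosed_finite ‹_›) ‹_›
      have hns : ¬ ExtVanish E' B := fun h => hcon ⟨K, E', f, g, hfg, hK, h⟩
      obtain ⟨E'', f', g', hfg', hno⟩ : ∃ (E'' : ModuleCat.{u} R) (f' : B →ₗ[R] E'')
          (g' : E'' →ₗ[R] E'), IsSES f' g' ∧ ¬ ∃ r : E'' →ₗ[R] B, ∀ x, r (f' x) = x := by
        by_contra h
        push Not at h
        exact hns (.of_splits h)
      obtain ⟨K', f'', i', p', h1, h2⟩ := hfg'.exists_comp hfg
      refine ⟨K', E'', f'', _, h1, .ext _ _ h2 .self hK, fun h => ?_, ?_⟩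
      -- A map nonzero on B restricts to an automorphism of the brick and would split the extension.
      -- So h factors through E', where the induction hypothesis applies.
      · have h0 : h ∘ₗ f' = 0 := by
          by_contra h0
          let e := LinearEquiv.ofBijective _ (hB.bijective _ h0)
          exact hno ⟨e.symm.toLinearMap ∘ₗ h, fun x => e.symm_apply_apply x⟩
        obtain ⟨h', hh'⟩ := hfg'.exists_desc h fun x => LinearMap.congr_fun h0 x
        ext x
        obtain ⟨y, hy⟩ := (hfg.exact (g' (f'' x))).1 (h1.comp_apply x)
        change h (f'' x) = 0
        rw [← hh', ← hy]
        exact LinearMap.congr_fun (hh h') y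
      · rw [Module.length_eq_add_of_exact _ _ h2.inj h2.surj h2.exact, Nat.cast_add, add_comm]
        exact add_le_add (Order.one_le_iff_pos.2 Module.length_pos) hn
  obtain ⟨K, E', f, g, h1, h2, h3, h4⟩ := key (c + 1)
  have := h4.trans (bound K E' f g h1 h2 h3)
  norm_cast at this
  omega

end BrickExtension

/-! ### Choosing indecomposable extensions -/

section Indecomposable

variable {R : Type u} [Ring R]

/-- Indecomposable modules, in terms of idempotent endomorphisms. -/
structure Indec (M : ModuleCat.{u} R) : Prop where
  nontrivial : Nontrivial M
  idem : ∀ φ : M →ₗ[R] M, (∀ x, φ (φ x) = φ x) → φ = 0 ∨ φ = LinearMap.id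

theorem Indec.indecomposable {M : ModuleCat.{u} R} (h : Indec M) : Indecomposable M := by
  refine ⟨fun h0 => ?_, fun Y Z e => ?_⟩
  · exact not_subsingleton_iff_nontrivial.2 h.nontrivial (ModuleCat.isZero_iff_subsingleton.1 h0)
  · let φ : M ⟶ M := e.hom ≫ biprod.fst ≫ biprod.inl ≫ e.inv
    have hφ : φ ≫ φ = φ := by simp [φ]
    rcases h.idem φ.hom (fun x => congrArg (fun t : M ⟶ M => t.hom x) hφ) with h0 | h1
    · left
      have : φ = 0 := ModuleCat.hom_ext h0
      rw [IsZero.iff_id_eq_zero]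
      have h2 : 𝟙 Y = biprod.inl ≫ e.inv ≫ φ ≫ e.hom ≫ biprod.fst := by simp [φ]
      rw [h2, this]; simp
    · right
      have : φ = 𝟙 M := ModuleCat.hom_ext h1
      rw [IsZero.iff_id_eq_zero]
      have h2 : 𝟙 Z = biprod.inr ≫ e.inv ≫ 𝟙 M ≫ e.hom ≫ biprod.snd := by simp
      rw [h2, ← this]; simp [φ]

theorem idem_id_sub {X : ModuleCat.{u} R} {φ : X →ₗ[R] X} (hφ : ∀ x, φ (φ x) = φ x) (x : X) :
    (LinearMap.id - φ : X →ₗ[R] X) ((LinearMap.id - φ : X →ₗ[R] X) x) =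
      (LinearMap.id - φ : X →ₗ[R] X) x := by
  simp [hφ]

theorem rangeRestrict_idem {X : ModuleCat.{u} R} {φ : X →ₗ[R] X} (hφ : ∀ x, φ (φ x) = φ x)
    (x : LinearMap.range φ) : φ.rangeRestrict (x : X) = x := by
  obtain ⟨_, y, rfl⟩ := x
  exact Subtype.ext (hφ y)

theorem RClosure.hom_eq_zero_left {B K W : ModuleCat.{u} R} (hK : RClosure B K)
    (h : ∀ f : B →ₗ[R] W, f = 0) (f : K →ₗ[R] W) : f = 0 :=
  hK.le (extClosed_hom_left W) (retractClosed_hom_left W) h f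

theorem RClosure.hom_eq_zero_right {B K W : ModuleCat.{u} R} (hK : RClosure B K)
    (h : ∀ f : W →ₗ[R] B, f = 0) (f : W →ₗ[R] K) : f = 0 :=
  hK.le (extClosed_hom_right W) (retractClosed_hom_right W) h f

variable [IsArtinianRing R]

/-- If one of the two summands given by an idempotent endomorphism always inherits a property of
finitely generated modules, then the property holds for some indecomposable module. -/
theorem exists_indec (V : ObjectProperty (ModuleCat.{u} R)) (hfin : ∀ X, V X → Module.Finite R X)
    (hnt : ∀ X, V X → Nontrivial X)
    (h : ∀ X, V X → ∀ φ : X →ₗ[R] X, (∀ x, φ (φ x) = φ x) → V (ModuleCat.of R (LinearMap.range φ)) ∨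
      V (ModuleCat.of R (LinearMap.range (LinearMap.id - φ)))) {X : ModuleCat.{u} R} (hX : V X) :
    ∃ Y, V Y ∧ Indec Y := by
  have key : ∀ (n : ℕ) (X : ModuleCat.{u} R), V X → Module.length R X ≤ n → ∃ Y, V Y ∧ Indec Y := by
    intro n
    induction n with
    | zero =>
      intro X hX hn
      exact absurd (Module.length_eq_zero_iff.1 (le_antisymm hn bot_le))
        (not_subsingleton_iff_nontrivial.2 (hnt X hX))
    | succ n ih =>
      intro X hX hn
      by_cases hI : Indec X
      · exact ⟨X, hX, hI⟩
      obtain ⟨φ, hφ, h0, h1⟩ : ∃ φ : X →ₗ[R] X, (∀ x, φ (φ x) = φ x) ∧ φ ≠ 0 ∧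
          φ ≠ LinearMap.id := by
        by_contra hcon
        push Not at hcon
        refine hI ⟨hnt X hX, fun φ hφ => ?_⟩
        by_cases h0 : φ = 0
        · exact .inl h0
        · exact .inr (hcon φ hφ h0)
      have := hfin X hX
      have hlt : ∀ N : Submodule R X, N ≠ ⊤ → Module.length R N ≤ n := by
        intro N hN
        have h2 := (Submodule.length_lt hN).trans_le hn
        exact Order.le_of_lt_add_one (by simpa using h2)
      rcases h X hX φ hφ with h2 | h2
      · refine ih _ h2 (hlt _ fun ht => h1 ?_)
        ext x
        obtain ⟨y, rfl⟩ := LinearMap.range_eq_top.1 ht x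
        exact hφ y
      · refine ih _ h2 (hlt _ fun ht => h0 ?_)
        ext x
        obtain ⟨y, rfl⟩ := LinearMap.range_eq_top.1 ht x
        simp [hφ]
  have := hfin X hX
  obtain ⟨n, hn⟩ := ENat.ne_top_iff_exists.1 (Module.length_ne_top (R := R) (M := X))
  exact key n X hX hn.ge

/-- Extensions of an indecomposable module by iterated self-extensions of `B` may be chosen
indecomposable. -/
theorem exists_indec_extension {B E : ModuleCat.{u} R} [Module.Finite R E] [Module.Finite R B]
    (hE : Indec E) (hBE : ∀ f : B →ₗ[R] E, f = 0)
    (hex : ∃ (K E' : ModuleCat.{u} R) (f : K →ₗ[R] E') (g : E' →ₗ[R] E), IsSES f g ∧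
      RClosure B K ∧ ExtVanish E' B) :
    ∃ (K E' : ModuleCat.{u} R) (f : K →ₗ[R] E') (g : E' →ₗ[R] E), IsSES f g ∧ RClosure B K ∧
      ExtVanish E' B ∧ Indec E' := by
  let V : ObjectProperty (ModuleCat.{u} R) := fun E' => ∃ (K : ModuleCat.{u} R) (f : K →ₗ[R] E')
    (g : E' →ₗ[R] E), IsSES f g ∧ RClosure B K ∧ ExtVanish E' B
  obtain ⟨K, E', hV⟩ := hex
  -- If g ∘ φ = g, the summand φ(X) still maps onto E, and the kernel there is a retract of K.
  have hred : ∀ (K X : ModuleCat.{u} R) (f : K →ₗ[R] X) (g : X →ₗ[R] E), IsSES f g →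
      RClosure B K → ExtVanish X B → ∀ φ : X →ₗ[R] X, (∀ x, φ (φ x) = φ x) →
      (∀ x, g (φ x) = g x) → V (ModuleCat.of R (LinearMap.range φ)) := by
    intro K X f g hs hK hX φ hφ hg
    have hsurj : Function.Surjective (g ∘ₗ (LinearMap.range φ).subtype) := fun e => by
      obtain ⟨x, rfl⟩ := hs.surj e
      exact ⟨⟨φ x, x, rfl⟩, hg x⟩
    have hs' : IsSES (Y := ModuleCat.of R (LinearMap.range φ)) _
      (g ∘ₗ (LinearMap.range φ).subtype) := IsSES.ker_subtype hsurj
    refine ⟨_, _, _, hs', ?_, ?_⟩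
    · obtain ⟨a, ha⟩ := hs.exists_lift ((LinearMap.range φ).subtype ∘ₗ
        (LinearMap.ker (g ∘ₗ (LinearMap.range φ).subtype)).subtype :
        ModuleCat.of R (LinearMap.ker (g ∘ₗ (LinearMap.range φ).subtype)) →ₗ[R] X)
        fun x => hs'.comp_apply x
      obtain ⟨b, hb⟩ := hs'.exists_lift (φ.rangeRestrict ∘ₗ f) fun x => by
        change g (φ (f x)) = 0
        rw [hg, hs.comp_apply]
      refine .retract a b (fun x => hs'.inj ?_) hK
      rw [hb, LinearMap.comp_apply, ha]
      exact rangeRestrict_idem hφ _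
    · exact .retract_left (X := ModuleCat.of R (LinearMap.range φ)) (LinearMap.range φ).subtype
        φ.rangeRestrict (rangeRestrict_idem hφ) hX
  obtain ⟨Y, ⟨K, f, g, h1, h2, h3⟩, hY⟩ := exists_indec V (by
    rintro X ⟨K, f, g, hs, hK, -⟩
    exact extClosed_finite.ext hs (hK.le extClosed_finite retractClosed_finite ‹_›) ‹_›) (by
    rintro X ⟨K, f, g, hs, hK, -⟩
    have := hE.nontrivial
    exact hs.surj.nontrivial) (by
    rintro X ⟨K, f, g, hs, hK, hX⟩ φ hφ
    -- Since Hom(B, E) = 0 forces Hom(K, E) = 0, φ induces an idempotent ψ of the indecomposable E.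
    -- It is 0 or 1, which decides whether the summand of 1 - φ or of φ is kept.
    obtain ⟨ψ, hψ⟩ := hs.exists_desc (g ∘ₗ φ) fun x =>
      LinearMap.congr_fun (hK.hom_eq_zero_left hBE (g ∘ₗ φ ∘ₗ f)) x
    have hψi : ∀ y, ψ (ψ y) = ψ y := by
      intro y
      obtain ⟨x, rfl⟩ := hs.surj y
      rw [hψ, LinearMap.comp_apply, hψ, LinearMap.comp_apply, hφ]
    rcases hE.idem ψ hψi with h0 | h0
    · right
      refine hred K X f g hs hK hX _ (idem_id_sub hφ) fun x => ?_
      have := hψ x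
      rw [h0] at this
      simp [LinearMap.comp_apply] at this
      simp [← this]
    · left
      refine hred K X f g hs hK hX _ hφ fun x => ?_
      have := hψ x
      rw [h0] at this
      exact this.symm) (X := E') ⟨K, hV⟩
  exact ⟨K, Y, f, g, h1, h2, h3, hY⟩

/-- Since Hom(E, B) = 0, an idempotent of the middle term restricts to E, where it is 0 or 1. The
summand containing E is kept; its quotient by E is a retract of K. -/
theorem exists_indec_coextension {B E : ModuleCat.{u} R} [Module.Finite R E] [Module.Finite R B]
    (hE : Indec E) (hEB : ∀ f : E →ₗ[R] B, f = 0)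
    (hex : ∃ (K E' : ModuleCat.{u} R) (f : E →ₗ[R] E') (g : E' →ₗ[R] K), IsSES f g ∧
      RClosure B K ∧ ExtVanish B E') :
    ∃ (K E' : ModuleCat.{u} R) (f : E →ₗ[R] E') (g : E' →ₗ[R] K), IsSES f g ∧ RClosure B K ∧
      ExtVanish B E' ∧ Indec E' := by
  let V : ObjectProperty (ModuleCat.{u} R) := fun E' => ∃ (K : ModuleCat.{u} R) (f : E →ₗ[R] E')
    (g : E' →ₗ[R] K), IsSES f g ∧ RClosure B K ∧ ExtVanish B E'
  obtain ⟨K, E', hV⟩ := hex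
  have hred : ∀ (K X : ModuleCat.{u} R) (f : E →ₗ[R] X) (g : X →ₗ[R] K), IsSES f g →
      RClosure B K → ExtVanish B X → ∀ φ : X →ₗ[R] X, (∀ x, φ (φ x) = φ x) →
      (∀ x, φ (f x) = f x) → V (ModuleCat.of R (LinearMap.range φ)) := by
    intro K X f g hs hK hX φ hφ hf
    let f' : E →ₗ[R] ModuleCat.of R (LinearMap.range φ) := φ.rangeRestrict ∘ₗ f
    have hf' : ∀ x, (LinearMap.range φ).subtype (f' x) = f x := hf
    have hs' : IsSES f' _ := IsSES.mkQ_range (fun x y hxy => hs.inj (by rw [← hf', hxy, hf']))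
    refine ⟨_, _, _, hs', ?_, ?_⟩
    · obtain ⟨a, ha⟩ := hs'.exists_desc (g ∘ₗ (LinearMap.range φ).subtype :
        ModuleCat.of R (LinearMap.range φ) →ₗ[R] K) fun x => by
          rw [LinearMap.comp_apply, hf', hs.comp_apply]
      obtain ⟨b, hb⟩ := hs.exists_desc ((LinearMap.range f').mkQ ∘ₗ φ.rangeRestrict :
        X →ₗ[R] ModuleCat.of R (_ ⧸ LinearMap.range f')) fun x => hs'.comp_apply x
      refine .retract a b (fun x => ?_) hK
      obtain ⟨y, rfl⟩ := hs'.surj x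
      rw [ha, LinearMap.comp_apply, hb]
      exact congrArg _ (rangeRestrict_idem hφ y)
    · exact .retract_right (X := ModuleCat.of R (LinearMap.range φ)) (LinearMap.range φ).subtype
        φ.rangeRestrict (rangeRestrict_idem hφ) hX
  obtain ⟨Y, ⟨K, f, g, h1, h2, h3⟩, hY⟩ := exists_indec V (by
    rintro X ⟨K, f, g, hs, hK, -⟩
    exact extClosed_finite.ext hs ‹_› (hK.le extClosed_finite retractClosed_finite ‹_›)) (by
    rintro X ⟨K, f, g, hs, hK, -⟩
    have := hE.nontrivial
    exact hs.inj.nontrivial) (by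
    rintro X ⟨K, f, g, hs, hK, hX⟩ φ hφ
    obtain ⟨ψ, hψ⟩ := hs.exists_lift (φ ∘ₗ f) fun x =>
      LinearMap.congr_fun (hK.hom_eq_zero_right hEB (g ∘ₗ φ ∘ₗ f)) x
    have hψi : ∀ y, ψ (ψ y) = ψ y := by
      intro y
      apply hs.inj
      rw [hψ, LinearMap.comp_apply, hψ, LinearMap.comp_apply, hφ]
    rcases hE.idem ψ hψi with h0 | h0
    · right
      refine hred K X f g hs hK hX _ (idem_id_sub hφ) fun x => ?_
      have := hψ x
      rw [h0] at this
      simp [LinearMap.comp_apply] at this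
      simp [← this]
    · left
      refine hred K X f g hs hK hX _ hφ fun x => ?_
      have := hψ x
      rw [h0] at this
      exact this.symm) (X := E') ⟨K, hV⟩
  exact ⟨K, Y, f, g, h1, h2, h3, hY⟩

/-- Extensions of a brick by its iterated self-extensions may be chosen indecomposable. -/
theorem exists_indec_self_extension {B : ModuleCat.{u} R} [Module.Finite R B] (hB : LinBrick B)
    (hex : ∃ (K E' : ModuleCat.{u} R) (f : K →ₗ[R] E') (g : E' →ₗ[R] B), IsSES f g ∧
      RClosure B K ∧ ExtVanish E' B) :
    ∃ (K E' : ModuleCat.{u} R) (f : K →ₗ[R] E') (g : E' →ₗ[R] B), IsSES f g ∧ RClosure B K ∧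
      ExtVanish E' B ∧ Indec E' := by
  let V : ObjectProperty (ModuleCat.{u} R) := fun E' => ∃ (K : ModuleCat.{u} R) (f : K →ₗ[R] E')
    (g : E' →ₗ[R] B), IsSES f g ∧ RClosure B K ∧ ExtVanish E' B
  obtain ⟨K, E', hV⟩ := hex
  have hred : ∀ (K X : ModuleCat.{u} R) (f : K →ₗ[R] X) (g : X →ₗ[R] B), IsSES f g →
      RClosure B K → ExtVanish X B → ∀ φ : X →ₗ[R] X, (∀ x, φ (φ x) = φ x) →
      g ∘ₗ φ ≠ 0 → V (ModuleCat.of R (LinearMap.range φ)) := by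
    intro K X f g hs hK hX φ hφ hg
    have hR : RClosure B (ModuleCat.of R (LinearMap.range φ)) :=
      .retract (X := ModuleCat.of R (LinearMap.range φ)) (LinearMap.range φ).subtype
        φ.rangeRestrict (rangeRestrict_idem hφ) (.ext f g hs hK .self)
    have hR' : ExtClosure B (ModuleCat.of R (LinearMap.range φ)) :=
      hR.le extClosed_ExtClosure (retractClosed_ExtClosure hB) .self
    obtain ⟨h1, h2⟩ := hR'.ker_mem hB (g ∘ₗ (LinearMap.range φ).subtype) (fun h => hg (by
      ext x
      exact LinearMap.congr_fun h ⟨φ x, x, rfl⟩))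
    exact ⟨_, _, _, IsSES.ker_subtype h1, h2.le extClosed_RClosure .self,
      .retract_left (X := ModuleCat.of R (LinearMap.range φ)) (LinearMap.range φ).subtype
        φ.rangeRestrict (rangeRestrict_idem hφ) hX⟩
  have := hB.nontrivial
  obtain ⟨Y, ⟨K, f, g, h1, h2, h3⟩, hY⟩ := exists_indec V (by
    rintro X ⟨K, f, g, hs, hK, -⟩
    exact extClosed_finite.ext hs (hK.le extClosed_finite retractClosed_finite ‹_›) ‹_›) (by
    rintro X ⟨K, f, g, hs, hK, -⟩
    exact hs.surj.nontrivial) (by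
    rintro X ⟨K, f, g, hs, hK, hX⟩ φ hφ
    -- Here Hom(K, B) need not vanish, so φ need not descend to B. But g ∘ φ and g ∘ (1 - φ) add up
    -- to g ≠ 0, and a nonzero map from an iterated self-extension of B to B is onto with kernel of
    -- the same kind.
    by_cases h0 : g ∘ₗ φ = 0
    · right
      refine hred K X f g hs hK hX _ (idem_id_sub hφ) fun h1 => ?_
      obtain ⟨b, hb⟩ := exists_ne (0 : B)
      obtain ⟨x, rfl⟩ := hs.surj b
      have h2 := LinearMap.congr_fun h0 x
      have h3 := LinearMap.congr_fun h1 x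
      simp only [LinearMap.comp_apply, LinearMap.sub_apply, LinearMap.id_apply, map_sub,
        LinearMap.zero_apply] at h2 h3
      rw [h2, sub_zero] at h3
      exact hb h3
    · exact .inl (hred K X f g hs hK hX _ hφ h0)) (X := E') ⟨K, hV⟩
  exact ⟨K, Y, f, g, h1, h2, h3, hY⟩

end Indecomposable

/-! ### Relative projective covers and injective hulls -/

section System

variable {R : Type u} [Ring R]

theorem LinBrick.isBrick {M : ModuleCat.{u} R} (h : LinBrick M) : IsBrick M := by
  refine ⟨fun h0 => not_subsingleton_iff_nontrivial.2 h.nontrivial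
    (ModuleCat.isZero_iff_subsingleton.1 h0), fun f hf => ?_⟩
  have := h.bijective f.hom fun h0 => hf (ModuleCat.hom_ext h0)
  exact (ConcreteCategory.isIso_iff_bijective f).2 this

/-- Every maximal submodule of an iterated self-extension `K` of `B` contains the kernel of a map
`K → B`. -/
def LiftsTops (B : ModuleCat.{u} R) : Prop :=
  ∀ K, RClosure B K → ∀ M : Submodule R K, IsCoatom M → ∃ f : K →ₗ[R] B, LinearMap.ker f ≤ M

/-- The properties of a family of (proper) standard modules that guarantee the existence of relative
projective covers. -/
structure IsExceptionalFamily {n : ℕ} (Θ : Fin n → ModuleCat.{u} R) : Prop where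
  finite : ∀ i, Module.Finite R (Θ i)
  indec : ∀ i, Indec (Θ i)
  brick_or_stone : ∀ i, (LinBrick (Θ i) ∧ LiftsTops (Θ i)) ∨ ExtVanish (Θ i) (Θ i)
  hom : ∀ i j, j < i → ∀ f : Θ i →ₗ[R] Θ j, f = 0
  ext : ∀ i j, j < i → ExtVanish (Θ i) (Θ j)

namespace IsExceptionalFamily

variable {n : ℕ} {Θ : Fin n → ModuleCat.{u} R}

theorem isBrick_or_isStone (h : IsExceptionalFamily Θ) (i : Fin n) :
    IsBrick (Θ i) ∨ IsStone (Θ i) :=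
  (h.brick_or_stone i).imp (fun h => h.1.isBrick) fun h' => ⟨(h.indec i).indecomposable, h'⟩

theorem hom_category (h : IsExceptionalFamily Θ) (i j : Fin n) (hij : j < i) (f : Θ i ⟶ Θ j) :
    f = 0 :=
  ModuleCat.hom_ext (h.hom i j hij f.hom)

theorem linBrick_or_extVanish (h : IsExceptionalFamily Θ) (i : Fin n) :
    LinBrick (Θ i) ∨ ExtVanish (Θ i) (Θ i) :=
  (h.brick_or_stone i).imp_left fun h => h.1

theorem extVanish_left {P X : ModuleCat.{u} R} (hP : ∀ i, ExtVanish P (Θ i))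
    (hX : filtFamily Θ X) : ExtVanish P X :=
  (extClosed_extVanish_right P).filtFamily_le (retractClosed_extVanish_right P) hP hX

theorem extVanish_right {I X : ModuleCat.{u} R} (hI : ∀ i, ExtVanish (Θ i) I)
    (hX : filtFamily Θ X) : ExtVanish X I :=
  (extClosed_extVanish_left I).filtFamily_le (retractClosed_extVanish_left I) hI hX

theorem negExt_eq_zero (M N : ModuleCat.{u} R) : IsZero ((negExt.obj (.op M)).obj N) :=
  AddCommGrpCat.isZero_of_subsingleton (AddCommGrpCat.of PUnit)

theorem finite_of_RClosure (h : IsExceptionalFamily Θ) {i : Fin n} {K : ModuleCat.{u} R}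
    (hK : RClosure (Θ i) K) : Module.Finite R K :=
  hK.le extClosed_finite retractClosed_finite (h.finite i)

variable [IsArtinianRing R]

theorem filtFamily_of_RClosure (h : IsExceptionalFamily Θ) {p : Fin n → Prop} {i : Fin n}
    (hi : p i) {K : ModuleCat.{u} R} (hK : RClosure (Θ i) K) :
    filtFamily (fun j : {j // p j} => Θ j) K :=
  have := h.finite i
  RClosure.filtFamily (fun j : {j // p j} => Θ j) ⟨i, hi⟩ (h.linBrick_or_extVanish i) hK

theorem filtFamily_of_RClosure' (h : IsExceptionalFamily Θ) {i : Fin n} {K : ModuleCat.{u} R}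
    (hK : RClosure (Θ i) K) : filtFamily Θ K :=
  have := h.finite i
  RClosure.filtFamily Θ i (h.linBrick_or_extVanish i) hK

/-- The relative projective cover of `Θ i` with respect to the first `m` members of `Θ`. -/
theorem exists_projective_step (𝕜 : Type v) [Field 𝕜] [Algebra 𝕜 R] [FiniteDimensional 𝕜 R]
    (h : IsExceptionalFamily Θ) (i : Fin n) (m : ℕ) (him : i.1 + 1 ≤ m) : m ≤ n →
    ∃ (K E : ModuleCat.{u} R) (f : K →ₗ[R] E) (g : E →ₗ[R] Θ i), IsSES f g ∧
      filtFamily (fun j : {j : Fin n // i ≤ j} => Θ j) K ∧ filtFamily Θ E ∧ Indec E ∧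
      Module.Finite R E ∧ (∀ k : Fin n, k.1 < m → ExtVanish E (Θ k)) ∧
      ∀ k : Fin n, m ≤ k.1 → ∀ f : Θ k →ₗ[R] E, f = 0 := by
  induction m, him using Nat.le_induction with
  | base =>
    intro _
    have := h.finite i
    -- First stage: a brick must be extended by itself to remove its self-extensions; a stone can be
    -- left alone.
    obtain ⟨K, E, f, g, hs, hK, hE, hI⟩ : ∃ (K E : ModuleCat.{u} R) (f : K →ₗ[R] E)
        (g : E →ₗ[R] Θ i), IsSES f g ∧ RClosure (Θ i) K ∧ ExtVanish E (Θ i) ∧ Indec E := by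
      rcases h.brick_or_stone i with ⟨hb, hl⟩ | hb
      · exact exists_indec_self_extension hb (exists_brick_extension 𝕜 hb hl)
      · exact ⟨ModuleCat.of R PUnit, Θ i, 0, LinearMap.id, ⟨fun _ _ _ => Subsingleton.elim _ _,
          fun y => ⟨fun h => ⟨0, h.symm⟩, fun ⟨x, hx⟩ => hx.symm⟩, Function.surjective_id⟩,
          .zero _ inferInstance, hb, h.indec i⟩
    have hEc : RClosure (Θ i) E := .ext f g hs hK .self
    refine ⟨K, E, f, g, hs, h.filtFamily_of_RClosure le_rfl hK, h.filtFamily_of_RClosure' hEc, hI,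
      h.finite_of_RClosure hEc, fun k hk => ?_, fun k hk => ?_⟩
    · rcases (Nat.lt_succ_iff.1 hk).lt_or_eq with hk | hk
      · exact hEc.le (extClosed_extVanish_left _) (retractClosed_extVanish_left _)
          (h.ext i k hk)
      · rwa [Fin.ext hk]
    · exact hEc.hom_eq_zero_right (h.hom k i hk)
  | succ m him ih =>
    intro hmn
    obtain ⟨K, E, f, g, hs, hK, hEΘ, hI, hfin, hext, hhom⟩ := ih (Nat.le_of_succ_le hmn)
    -- Passing from m to m + 1 extends by Θ m. The condition Hom(Θ m, E) = 0, carried along in the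
    -- induction, keeps the extension indecomposable.
    let j : Fin n := ⟨m, hmn⟩
    have := h.finite j
    obtain ⟨K', E', f', g', hs', hK', hE', hI'⟩ := exists_indec_extension (B := Θ j) hI
      (hhom j le_rfl) (by
        rcases h.brick_or_stone j with ⟨hb, hl⟩ | hb
        · exact exists_brick_extension 𝕜 hb hl
        · exact exists_universal_extension 𝕜 hb)
    obtain ⟨K'', f'', i', p', h1, h2⟩ := hs'.exists_comp hs
    refine ⟨K'', E', f'', _, h1, (extClosed_filtFamily _).ext h2
      (h.filtFamily_of_RClosure (Nat.le_of_succ_le him) hK') hK,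
      (extClosed_filtFamily _).ext hs' (h.filtFamily_of_RClosure' hK') hEΘ, hI',
      extClosed_finite.ext hs' (h.finite_of_RClosure hK') hfin, fun k hk => ?_, fun k hk => ?_⟩
    · rcases (Nat.lt_succ_iff.1 hk).lt_or_eq with hk | hk
      -- Earlier vanishing survives, because Ext¹(Θ m, Θ k) = 0 for k < m.
      · exact .of_ses_left hs' (hK'.le (extClosed_extVanish_left _)
          (retractClosed_extVanish_left _) (h.ext j k hk)) (hext k hk)
      · rwa [show k = j from Fin.ext hk]
    · exact (extClosed_hom_right (Θ k)).ext hs' (hK'.hom_eq_zero_right (h.hom k j hk))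
        (hhom k (Nat.le_of_succ_le hk))

/-- The relative injective hull of `Θ i` with respect to the members `Θ k` with `k + d ≥ i`. -/
theorem exists_injective_step (𝕜 : Type v) [Field 𝕜] [Algebra 𝕜 R] [FiniteDimensional 𝕜 R]
    (h : IsExceptionalFamily Θ) (hst : ∀ i, ExtVanish (Θ i) (Θ i)) (i : Fin n) (d : ℕ) :
    d ≤ i.1 →
    ∃ (K E : ModuleCat.{u} R) (f : Θ i →ₗ[R] E) (g : E →ₗ[R] K), IsSES f g ∧
      filtFamily (fun j : {j : Fin n // j ≤ i} => Θ j) K ∧ filtFamily Θ E ∧ Indec E ∧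
      Module.Finite R E ∧ (∀ k : Fin n, i.1 ≤ k.1 + d → ExtVanish (Θ k) E) ∧
      ∀ k : Fin n, k.1 + d < i.1 → ∀ f : E →ₗ[R] Θ k, f = 0 := by
  induction d with
  | zero =>
    intro _
    refine ⟨ModuleCat.of R PUnit, Θ i, LinearMap.id, 0, ⟨Function.injective_id,
      fun y => ⟨fun _ => ⟨y, rfl⟩, fun _ => rfl⟩, fun _ => ⟨0, Subsingleton.elim _ _⟩⟩,
      (extClosed_filtFamily _).zero _ (inferInstanceAs (Subsingleton PUnit)),
      filtFamily_self Θ i, h.indec i, h.finite i, fun k hk => ?_, fun k hk => h.hom i k hk⟩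
    rcases hk.lt_or_eq with hk | hk
    · exact h.ext k i hk
    · rw [← show i = k from Fin.ext hk]; exact hst i
  | succ d ih =>
    intro hd
    obtain ⟨K, E, f, g, hs, hK, hEΘ, hI, hfin, hext, hhom⟩ := ih (Nat.le_of_succ_le hd)
    -- The coextensions run downwards from i: stage d + 1 treats the index i - (d + 1).
    let j : Fin n := ⟨i.1 - (d + 1), by omega⟩
    have hj : j.1 + (d + 1) = i.1 := Nat.sub_add_cancel hd
    have := h.finite j
    obtain ⟨K', E', f', g', hs', hK', hE', hI'⟩ := exists_indec_coextension (B := Θ j) hI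
      (hhom j (by omega)) (exists_universal_coextension 𝕜 (hst j))
    obtain ⟨Q, q, a, b, h1, h2⟩ := hs.exists_quotient hs'
    refine ⟨Q, E', _, q, h1, (extClosed_filtFamily _).ext h2 hK
      (h.filtFamily_of_RClosure (i := j) (show j ≤ i from Fin.le_def.2 (Nat.sub_le _ _)) hK'),
      (extClosed_filtFamily _).ext hs' hEΘ (h.filtFamily_of_RClosure' hK'), hI',
      extClosed_finite.ext hs' hfin (h.finite_of_RClosure hK'), fun k hk => ?_, fun k hk => ?_⟩
    · by_cases hkj : k = j
      · rwa [hkj]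
      · have hjk : j.1 < k.1 := by
          have : k.1 ≠ j.1 := fun h => hkj (Fin.ext h)
          omega
        exact .of_ses_right hs' (hext k (by omega)) (hK'.le (extClosed_extVanish_right _)
          (retractClosed_extVanish_right _) (h.ext k j hjk))
    · exact (extClosed_hom_left (Θ k)).ext hs' (hhom k (by omega))
        (hK'.hom_eq_zero_left (h.hom j k (Fin.lt_def.2 (by omega))))

theorem exists_stratifying (𝕜 : Type v) [Field 𝕜] [Algebra 𝕜 R] [FiniteDimensional 𝕜 R]
    (h : IsExceptionalFamily Θ) :
    ∃ P : Fin n → ModuleCat.{u} R, IsProjectiveIn (filtFamily Θ) (directSum P) ∧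
      IsMixedStratifyingSystem Θ P := by
  -- At m = n, Ext¹ from P i vanishes against every member of Θ, hence against all of F(Θ).
  choose K P f g hs hK hPΘ hI hfin hext _ using
    fun i => h.exists_projective_step 𝕜 i n i.2 le_rfl
  have hP : ∀ i X, filtFamily Θ X → ExtVanish (P i) X := fun i X hX =>
    extVanish_left (fun k => hext i k k.2) hX
  refine ⟨P, ⟨(extClosed_filtFamily Θ).pi_fin P hPΘ, fun X hX =>
    (extClosed_extVanish_left X).pi_fin P fun i => hP i X hX⟩, ?_⟩
  exact ⟨h.finite, hfin, fun i => (hI i).indecomposable, h.isBrick_or_isStone, h.hom_category,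
    fun i => ⟨K i, _, _, _, (hs i).shortExact, hK i, hP i⟩, negExt_eq_zero _ _⟩

theorem exists_costratifying (𝕜 : Type v) [Field 𝕜] [Algebra 𝕜 R] [FiniteDimensional 𝕜 R]
    (h : IsExceptionalFamily Θ) (hst : ∀ i, ExtVanish (Θ i) (Θ i)) :
    ∃ I : Fin n → ModuleCat.{u} R, IsInjectiveIn (filtFamily Θ) (directSum I) ∧
      IsMixedCostratifyingSystem Θ I := by
  -- At d = i the restriction i ≤ k + d is void, so every Θ k is covered.
  choose K I f g hs hK hIΘ hI hfin hext _ using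
    fun i => h.exists_injective_step 𝕜 hst i i.1 le_rfl
  have hI' : ∀ i X, filtFamily Θ X → ExtVanish X (I i) := fun i X hX =>
    extVanish_right (fun k => hext i k (Nat.le_add_left _ _)) hX
  refine ⟨I, ⟨(extClosed_filtFamily Θ).pi_fin I hIΘ, fun X hX =>
    (extClosed_extVanish_right X).pi_fin I fun i => hI' i X hX⟩, ?_⟩
  exact ⟨h.finite, hfin, fun i => (hI i).indecomposable, h.isBrick_or_isStone, h.hom_category,
    fun i => ⟨K i, _, _, _, (hs i).shortExact, hI' i, hK i⟩, negExt_eq_zero _ _⟩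

end IsExceptionalFamily

end System

/-! ### Modules with a largest proper submodule -/

section LocalModule

variable {R : Type u} [Ring R]

/-- `J` is the largest proper submodule of `M`. -/
structure IsLargestProper {M : Type u} [AddCommGroup M] [Module R M] (J : Submodule R M) : Prop where
  coatom : IsCoatom J
  le : ∀ N : Submodule R M, N ≠ ⊤ → N ≤ J

namespace IsLargestProper

variable {M M' : Type u} [AddCommGroup M] [Module R M] [AddCommGroup M'] [Module R M']
  {J : Submodule R M}

theorem jacobson_eq (h : IsLargestProper J) : Module.jacobson R M = J :=
  le_antisymm (sInf_le h.coatom) (le_sInf fun N hN => by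
    rcases hN.le_iff.1 (h.le N hN.1) with h1 | h1
    · exact absurd h1 h.coatom.1
    · exact h1.le)

theorem map (h : IsLargestProper J) (q : M →ₗ[R] M') (hq : Function.Surjective q)
    (hk : LinearMap.ker q ≤ J) : IsLargestProper (J.map q) where
  coatom := Submodule.isCoatom_map_of_ker_le hq hk h.coatom
  le N hN := by
    have h1 : N.comap q ≠ ⊤ := fun h1 => hN (by
      rw [← Submodule.map_comap_eq_of_surjective hq N, h1, Submodule.map_top,
        LinearMap.range_eq_top.2 hq])
    rw [← Submodule.map_comap_eq_of_surjective hq N]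
    exact Submodule.map_mono (h.le _ h1)

theorem nontrivial (h : IsLargestProper J) : Nontrivial M := by
  by_contra hM
  rw [not_nontrivial_iff_subsingleton] at hM
  exact h.coatom.1 (Subsingleton.elim _ _)

/-- For an idempotent that is neither 0 nor 1, kernel and range are both proper, hence both inside
J, although together they span M. -/
theorem indec {M : ModuleCat.{u} R} {J : Submodule R M} (h : IsLargestProper J) : Indec M := by
  refine ⟨h.nontrivial, fun φ hφ => ?_⟩
  by_cases h1 : LinearMap.range φ = ⊤
  · right
    ext x
    obtain ⟨y, rfl⟩ := LinearMap.range_eq_top.1 h1 x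
    exact hφ y
  · left
    by_contra h2
    have h3 : LinearMap.ker φ ≠ ⊤ := fun h3 => h2 (LinearMap.ker_eq_top.1 h3)
    refine h.coatom.1 (eq_top_iff.2 fun x _ => ?_)
    have h4 : x - φ x ∈ J := h.le _ h3 (by simp [hφ])
    simpa using J.add_mem h4 (h.le _ h1 ⟨x, rfl⟩)

end IsLargestProper

end LocalModule

/-! ### The right ideal of a primitive idempotent is local -/

section RightIdeal

variable {A : Type u} [Ring A] {e : A}

theorem mem_span_idem (he : IsIdempotentElem e) {x : A} :
    x ∈ Submodule.span Aᵐᵒᵖ ({e} : Set A) ↔ e * x = x := by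
  rw [Submodule.mem_span_singleton]
  constructor
  · rintro ⟨a, rfl⟩
    change e * (e * a.unop) = e * a.unop
    rw [← mul_assoc, he.eq]
  · intro h
    exact ⟨op x, h⟩

/-- The generator `e` of `eA`. -/
def idealGen (e : A) : idealOf e := ⟨e, Submodule.mem_span_singleton_self e⟩

theorem idealGen_smul (he : IsIdempotentElem e) : op e • idealGen e = idealGen e :=
  Subtype.ext he.eq

theorem span_idealGen : Submodule.span Aᵐᵒᵖ ({idealGen e} : Set (idealOf e)) = ⊤ := by
  rw [eq_top_iff]
  rintro ⟨x, hx⟩ -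
  obtain ⟨a, rfl⟩ := Submodule.mem_span_singleton.1 hx
  exact Submodule.mem_span_singleton.2 ⟨a, rfl⟩

theorem exists_hom_idealOf (e : A) (M : ModuleCat.{u} Aᵐᵒᵖ) (x : M) :
    ∃ f : idealOf e →ₗ[Aᵐᵒᵖ] M, f (idealGen e) = op e • x :=
  ⟨{ toFun := fun a => op a.1 • x
     map_add' := fun a b => by rw [← add_smul]; rfl
     map_smul' := fun r a => by rw [RingHom.id_apply, ← mul_smul]; rfl }, rfl⟩

theorem projective_idealOf (he : IsIdempotentElem e) : Module.Projective Aᵐᵒᵖ (idealOf e) := by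
  let E : Aᵐᵒᵖ ≃ₗ[Aᵐᵒᵖ] A :=
    { toFun := unop
      invFun := op
      map_add' := fun _ _ => rfl
      map_smul' := fun _ _ => rfl
      left_inv := fun _ => rfl
      right_inv := fun _ => rfl }
  have : Module.Projective Aᵐᵒᵖ A := .of_equiv E
  refine Module.Projective.of_split (M := A) (Submodule.span Aᵐᵒᵖ ({e} : Set A)).subtype
    { toFun := fun a => ⟨e * a, (mem_span_idem he).2 (by rw [← mul_assoc, he.eq])⟩
      map_add' := fun a b => Subtype.ext (mul_add e a b)
      map_smul' := fun r a => Subtype.ext (mul_assoc e a r.unop).symm } ?_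
  exact LinearMap.ext fun a => Subtype.ext ((mem_span_idem he).1 a.2)

theorem finite_idealOf : Module.Finite Aᵐᵒᵖ (idealOf e) :=
  ⟨⟨{idealGen e}, by simpa using span_idealGen⟩⟩

/-- Left multiplication by an element of `eA` on `eA`. -/
def leftMul (u : idealOf e) : idealOf e →ₗ[Aᵐᵒᵖ] idealOf e where
  toFun a := op a.1 • u
  map_add' a b := by rw [← add_smul]; rfl
  map_smul' r a := by rw [RingHom.id_apply, ← mul_smul]; rfl

/-- Write e = u + v along U ⊕ V. From u = eu = u² + vu, the element vu = u - u² lies in U ∩ V = 0.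
By symmetry u and v are orthogonal idempotents, so one of them is zero. -/
theorem IsPrimitiveIdem.isCompl_eq (he : IsPrimitiveIdem e) {U V : Submodule Aᵐᵒᵖ (idealOf e)}
    (h : IsCompl U V) : U = ⊤ ∨ V = ⊤ := by
  obtain ⟨hi, -, hp⟩ := he
  have hmem : idealGen e ∈ U ⊔ V := by rw [h.sup_eq_top]; trivial
  obtain ⟨u, hu, v, hv, huv⟩ := Submodule.mem_sup.1 hmem
  have huv' : u.1 + v.1 = e := congrArg Subtype.val huv
  have heu : e * u.1 = u.1 := (mem_span_idem hi).1 u.2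
  have hev : e * v.1 = v.1 := (mem_span_idem hi).1 v.2
  have key : ∀ {U V : Submodule Aᵐᵒᵖ (idealOf e)}, Disjoint U V → ∀ u ∈ U, ∀ v ∈ V,
      u.1 + v.1 = e → e * u.1 = u.1 → v.1 * u.1 = 0 ∧ u.1 * u.1 = u.1 := by
    intro U V hd u hu v hv h1 h2
    have h3 : u.1 * u.1 + v.1 * u.1 = u.1 := by rw [← add_mul, h1, h2]
    have h4 : op u.1 • v ∈ U := by
      have : op u.1 • v = u - op u.1 • u := Subtype.ext (eq_sub_of_add_eq' h3)
      rw [this]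
      exact U.sub_mem hu (U.smul_mem _ hu)
    have h5 := Submodule.disjoint_def.1 hd _ h4 (V.smul_mem _ hv)
    have h6 : v.1 * u.1 = 0 := congrArg Subtype.val h5
    exact ⟨h6, by simpa [h6] using h3⟩
  obtain ⟨h1, h2⟩ := key h.disjoint u hu v hv huv' heu
  obtain ⟨h3, h4⟩ := key h.disjoint.symm v hv u hu (by rw [add_comm, huv']) hev
  have htop : ∀ W : Submodule Aᵐᵒᵖ (idealOf e), idealGen e ∈ W → W = ⊤ := by
    intro W hW
    rw [eq_top_iff, ← span_idealGen, Submodule.span_le]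
    simpa using hW
  rcases hp u.1 v.1 h2 h4 h3 h1 huv'.symm with h5 | h5
  · right
    refine htop V ?_
    have : idealGen e = v := Subtype.ext (by rw [h5, zero_add] at huv'; exact huv'.symm)
    rwa [this]
  · left
    refine htop U ?_
    have : idealGen e = u := Subtype.ext (by rw [h5, add_zero] at huv'; exact huv'.symm)
    rwa [this]

/-- Write e = u + v with u in U and v in V; left multiplications by u and v add up to the identity
of eA. By Fitting's lemma and indecomposability, either u acts nilpotently, so v acts invertibly and
V is everything, or a power of u acts surjectively and U is everything. -/
theorem IsPrimitiveIdem.sup_eq_top [IsArtinianRing Aᵐᵒᵖ] (he : IsPrimitiveIdem e)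
    {U V : Submodule Aᵐᵒᵖ (idealOf e)} (h : U ⊔ V = ⊤) : U = ⊤ ∨ V = ⊤ := by
  have hfin : Module.Finite Aᵐᵒᵖ (idealOf e) := finite_idealOf
  have hmem : idealGen e ∈ U ⊔ V := by rw [h]; trivial
  obtain ⟨u, hu, v, hv, huv⟩ := Submodule.mem_sup.1 hmem
  have hrange : ∀ (W : Submodule Aᵐᵒᵖ (idealOf e)) (w : idealOf e), w ∈ W →
      LinearMap.range (leftMul w) ≤ W := by
    rintro W w hw _ ⟨a, rfl⟩
    exact W.smul_mem _ hw
  have hsum : leftMul u + leftMul v = 1 := by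
    refine LinearMap.ext fun a => Subtype.ext ?_
    have h1 : (u.1 + v.1) * a.1 = a.1 := by
      rw [show u.1 + v.1 = e from congrArg Subtype.val huv]
      exact (mem_span_idem he.1).1 a.2
    rw [add_mul] at h1
    exact h1
  -- The exponent must be at least 1, so that the range of the power lies in the range of `leftMul
  -- u`.
  obtain ⟨n, hn, hn1⟩ := ((LinearMap.eventually_isCompl_ker_pow_range_pow (leftMul u)).and
    (Filter.eventually_ge_atTop 1)).exists
  rcases he.isCompl_eq hn with h1 | h1
  · right
    have hnil : IsNilpotent (leftMul u) := ⟨n, LinearMap.ker_eq_top.1 h1⟩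
    have hunit := hnil.isUnit_one_sub
    rw [← hsum, add_sub_cancel_left] at hunit
    refine eq_top_iff.2 (le_trans ?_ (hrange V v hv))
    rw [LinearMap.range_eq_top.2 ((Module.End.isUnit_iff _).1 hunit).2]
  · left
    refine eq_top_iff.2 (le_trans ?_ (hrange U u hu))
    obtain ⟨n, rfl⟩ := Nat.exists_eq_add_of_le' hn1
    rw [← h1, pow_succ']
    exact LinearMap.range_comp_le_range _ _

theorem IsPrimitiveIdem.isLargestProper [IsArtinianRing Aᵐᵒᵖ] (he : IsPrimitiveIdem e) :
    IsLargestProper (Module.jacobson Aᵐᵒᵖ (idealOf e)) := by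
  have hfin : Module.Finite Aᵐᵒᵖ (idealOf e) := finite_idealOf
  have hne : (⊥ : Submodule Aᵐᵒᵖ (idealOf e)) ≠ ⊤ := by
    intro h
    have : idealGen e ∈ (⊥ : Submodule Aᵐᵒᵖ (idealOf e)) := h ▸ trivial
    have h0 : idealGen e = 0 := (Submodule.mem_bot Aᵐᵒᵖ).1 this
    exact he.2.1 (congrArg Subtype.val h0)
  obtain ⟨J, hJ, -⟩ := (eq_top_or_exists_le_coatom (⊥ : Submodule Aᵐᵒᵖ (idealOf e))).resolve_left
    hne
  have hloc : IsLargestProper J := ⟨hJ, fun N hN => by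
    by_contra hle
    have h1 : N ⊔ J = ⊤ := hJ.2 _ (right_lt_sup.2 hle)
    exact (he.sup_eq_top h1).elim hN hJ.1⟩
  rwa [hloc.jacobson_eq]

end RightIdeal

/-! ### Standard and proper standard modules -/

section Standard

variable {A : Type u} [Ring A] {n : ℕ} {e : Fin n → A}

/-- Finitely generated modules `M` with `M e k = 0` unless `p k`. -/
def SupportedOn (e : Fin n → A) (p : Fin n → Prop) : ObjectProperty (ModuleCat.{u} Aᵐᵒᵖ) :=
  fun M => Module.Finite Aᵐᵒᵖ M ∧ ∀ k, ¬ p k → ∀ x : M, op (e k) • x = 0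

theorem op_smul_smul {a : A} (ha : IsIdempotentElem a) {M : Type u} [AddCommGroup M]
    [Module Aᵐᵒᵖ M] (x : M) : op a • op a • x = op a • x := by
  rw [← mul_smul, ← op_mul, ha.eq]

theorem extClosed_supportedOn (he : IsCompletePrimitive e) (p : Fin n → Prop) :
    ExtClosed (SupportedOn e p) where
  zero X hX := ⟨inferInstance, fun _ _ _ => Subsingleton.elim _ _⟩
  ext := by
    intro X Y Z f g hs hX hZ
    refine ⟨extClosed_finite.ext hs hX.1 hZ.1, fun k hk y => ?_⟩
    obtain ⟨x, hx⟩ := (hs.exact (op (e k) • y)).1 (by rw [map_smul, hZ.2 k hk])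
    rw [← op_smul_smul (he.primitive k).1, ← hx, ← map_smul, hX.2 k hk, map_zero]

theorem retractClosed_supportedOn (p : Fin n → Prop) : RetractClosed (SupportedOn e p) := by
  intro X Y i r hri h
  refine ⟨retractClosed_finite i r hri h.1, fun k hk x => ?_⟩
  rw [← hri x, ← map_smul, h.2 k hk, map_zero]

/-- The smallest submodule `U` of `M` that contains `L e k` for all `k` with `p k` has no nonzero maps
to modules `Y` with `Y e k = 0` for all `k` with `p k`. -/
theorem sInf_of_forall_iff (he : ∀ k, IsIdempotentElem (e k)) {M : Type u} [AddCommGroup M]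
    [Module Aᵐᵒᵖ M] (L : Submodule Aᵐᵒᵖ M) (p : Fin n → Prop) (𝒰 : Set (Submodule Aᵐᵒᵖ M))
    (h𝒰 : ∀ U, U ∈ 𝒰 ↔ ∀ k, p k → ∀ x ∈ L, op (e k) • x ∈ U) :
    (∀ k, p k → ∀ x ∈ L, op (e k) • x ∈ sInf 𝒰) ∧
      ∀ Y : ModuleCat.{u} Aᵐᵒᵖ, (∀ k, p k → ∀ y : Y, op (e k) • y = 0) →
        ∀ f : (sInf 𝒰 : Submodule Aᵐᵒᵖ M) →ₗ[Aᵐᵒᵖ] Y, f = 0 := by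
  have hmem : ∀ k, p k → ∀ x ∈ L, op (e k) • x ∈ sInf 𝒰 := fun k hk x hx =>
    (Submodule.mem_sInf).2 fun U hU => (h𝒰 U).1 hU k hk x hx
  refine ⟨hmem, fun Y hY f => ?_⟩
  -- Minimality: since x e_k = (x e_k) e_k with x e_k already in the infimum, f kills it. So ker f
  -- again belongs to 𝒰 and must be the whole infimum.
  have h1 : (LinearMap.ker f).map (sInf 𝒰).subtype ∈ 𝒰 := by
    rw [h𝒰]
    intro k hk x hx
    refine ⟨⟨_, hmem k hk x hx⟩, ?_, rfl⟩
    have h2 : (⟨_, hmem k hk x hx⟩ : (sInf 𝒰 : Submodule Aᵐᵒᵖ M)) =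
        op (e k) • ⟨_, hmem k hk x hx⟩ := Subtype.ext (op_smul_smul (he k) x).symm
    change f _ = 0
    rw [h2, map_smul, hY k hk]
  ext x
  obtain ⟨y, hy, hyx⟩ := sInf_le h1 x.2
  rw [← Subtype.ext hyx]
  exact hy

/-- Common properties of the standard and the proper standard module at `i`. -/
structure StandardLike (e : Fin n → A) (i : Fin n) (M : ModuleCat.{u} Aᵐᵒᵖ) : Prop where
  finite : Module.Finite Aᵐᵒᵖ M
  gen : ∃ g : M, op (e i) • g = g ∧ Submodule.span Aᵐᵒᵖ {g} = ⊤
  kills : ∀ k, i < k → ∀ x : M, op (e k) • x = 0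
  ext : ∀ Y : ModuleCat.{u} Aᵐᵒᵖ, (∀ k, i ≤ k → ∀ y : Y, op (e k) • y = 0) → ExtVanish M Y
  isLocal : ∃ J : Submodule Aᵐᵒᵖ M, IsLargestProper J

/-- `Ext¹(M, Y) = 0` whenever `Y e k = 0` for all `k > i`. -/
def StoneLike (e : Fin n → A) (i : Fin n) (M : ModuleCat.{u} Aᵐᵒᵖ) : Prop :=
  ∀ Y : ModuleCat.{u} Aᵐᵒᵖ, (∀ k, i < k → ∀ y : Y, op (e k) • y = 0) → ExtVanish M Y

/-- `M` has a largest proper submodule `J`, and `J e k = 0` for all `k ≥ i`. -/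
def ProperLike (e : Fin n → A) (i : Fin n) (M : ModuleCat.{u} Aᵐᵒᵖ) : Prop :=
  ∃ J : Submodule Aᵐᵒᵖ M, IsLargestProper J ∧ ∀ k, i ≤ k → ∀ x ∈ J, op (e k) • x = 0

variable {i : Fin n} {M M' : ModuleCat.{u} Aᵐᵒᵖ}

theorem StandardLike.of_linearEquiv (h : StandardLike e i M) (φ : M ≃ₗ[Aᵐᵒᵖ] M') :
    StandardLike e i M' where
  finite := have := h.finite; Module.Finite.equiv φ
  gen := by
    obtain ⟨g, hg, hs⟩ := h.gen
    refine ⟨φ g, by rw [← map_smul, hg], ?_⟩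
    have h1 := congrArg (Submodule.map (φ : M →ₗ[Aᵐᵒᵖ] M')) hs
    rw [Submodule.map_span, Set.image_singleton, Submodule.map_top, LinearEquiv.range] at h1
    exact h1
  kills k hk x := by
    obtain ⟨y, rfl⟩ := φ.surjective x
    rw [← map_smul, h.kills k hk, map_zero]
  ext Y hY := .retract_left (φ.symm : M' →ₗ[Aᵐᵒᵖ] M) (φ : M →ₗ[Aᵐᵒᵖ] M')
    (fun x => φ.apply_symm_apply x) (h.ext Y hY)
  isLocal := by
    obtain ⟨J, hJ⟩ := h.isLocal
    exact ⟨_, hJ.map (φ : M →ₗ[Aᵐᵒᵖ] M') φ.surjective (by simp)⟩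

theorem StoneLike.of_linearEquiv (h : StoneLike e i M) (φ : M ≃ₗ[Aᵐᵒᵖ] M') :
    StoneLike e i M' := fun Y hY =>
  .retract_left (φ.symm : M' →ₗ[Aᵐᵒᵖ] M) (φ : M →ₗ[Aᵐᵒᵖ] M')
    (fun x => φ.apply_symm_apply x) (h Y hY)

theorem ProperLike.of_linearEquiv (h : ProperLike e i M) (φ : M ≃ₗ[Aᵐᵒᵖ] M') :
    ProperLike e i M' := by
  obtain ⟨J, hJ, hk⟩ := h
  refine ⟨_, hJ.map (φ : M →ₗ[Aᵐᵒᵖ] M') φ.surjective (by simp), fun k hik x hx => ?_⟩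
  obtain ⟨y, hy, rfl⟩ := hx
  rw [← map_smul, hk k hik y hy, map_zero]

theorem StandardLike.hom_eq_zero (h : StandardLike e i M) {Y : ModuleCat.{u} Aᵐᵒᵖ}
    (hY : ∀ y : Y, op (e i) • y = 0) (f : M →ₗ[Aᵐᵒᵖ] Y) : f = 0 := by
  obtain ⟨g, hg, hs⟩ := h.gen
  refine LinearMap.ext_on hs fun x hx => ?_
  rw [Set.mem_singleton_iff.1 hx, ← hg, map_smul, hY]; rfl

/-- The hypothesis Hom(N, Y) = 0 makes Ext¹(M/N, Y) embed in Ext¹(M, Y) = 0. -/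
theorem StandardLike.quotient (h : StandardLike e i M)
    (N : Submodule Aᵐᵒᵖ M) (hN : N ≠ ⊤) (hY : ∀ Y : ModuleCat.{u} Aᵐᵒᵖ,
      (∀ k, i ≤ k → ∀ y : Y, op (e k) • y = 0) → ∀ f : N →ₗ[Aᵐᵒᵖ] Y, f = 0) :
    StandardLike e i (ModuleCat.of Aᵐᵒᵖ (M ⧸ N)) where
  finite := have := h.finite; inferInstanceAs (Module.Finite Aᵐᵒᵖ (M ⧸ N))
  gen := by
    obtain ⟨g, hg, hs⟩ := h.gen
    refine ⟨Submodule.Quotient.mk g, congrArg (Submodule.Quotient.mk (p := N)) hg, ?_⟩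
    have h1 := congrArg (Submodule.map N.mkQ) hs
    rw [Submodule.map_span, Set.image_singleton, Submodule.map_top, Submodule.range_mkQ] at h1
    exact h1
  kills k hk x := by
    obtain ⟨y, rfl⟩ := Submodule.Quotient.mk_surjective N x
    exact congrArg (Submodule.Quotient.mk (p := N)) (h.kills k hk y)
  ext Y hYk := .of_extends (IsSES.mkQ N) (h.ext Y hYk) fun φ => ⟨0, fun x => by
    rw [hY Y hYk φ]; rfl⟩
  isLocal := by
    obtain ⟨J, hJ⟩ := h.isLocal
    exact ⟨_, hJ.map N.mkQ N.mkQ_surjective (by rw [Submodule.ker_mkQ]; exact hJ.le _ hN)⟩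

/-- A simple quotient T of K receives a nonzero map from M, for otherwise Hom(K, T) = 0. Its kernel
lies in J, so Ext¹(M, -) and hence Ext¹(K, -) vanish on it, and K → T lifts along M → T to a map K →
M. -/
theorem StandardLike.liftsTops (h : StandardLike e i M) (hp : ProperLike e i M) : LiftsTops M := by
  obtain ⟨J, hJ, hk⟩ := hp
  intro K hK N hN
  have hT : IsSimpleModule Aᵐᵒᵖ (K ⧸ N) := isSimpleModule_iff_isCoatom.2 hN
  obtain ⟨u, hu⟩ : ∃ u : M →ₗ[Aᵐᵒᵖ] ModuleCat.of Aᵐᵒᵖ (K ⧸ N), u ≠ 0 := by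
    by_contra hcon
    push Not at hcon
    have h0 := hK.hom_eq_zero_left hcon N.mkQ
    refine hN.1 (eq_top_iff.2 fun x _ => ?_)
    rw [← Submodule.ker_mkQ N, LinearMap.mem_ker]
    exact LinearMap.congr_fun h0 x
  have hsurj : Function.Surjective u := LinearMap.surjective_of_ne_zero hu
  have hkJ : LinearMap.ker u ≤ J := hJ.le _ fun h0 => hu (LinearMap.ker_eq_top.1 h0)
  have hext : ExtVanish K (ModuleCat.of Aᵐᵒᵖ (LinearMap.ker u)) :=
    hK.le (extClosed_extVanish_left _) (retractClosed_extVanish_left _)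
      (h.ext (ModuleCat.of Aᵐᵒᵖ (LinearMap.ker u)) fun k hik (y : LinearMap.ker u) =>
        Subtype.ext (hk k hik _ (hkJ y.2)))
  obtain ⟨f, hf⟩ := hext.exists_lift (IsSES.ker_subtype hsurj) N.mkQ
  refine ⟨f, fun x hx => ?_⟩
  rw [← Submodule.ker_mkQ N, LinearMap.mem_ker]
  exact (hf x).symm.trans (by rw [LinearMap.mem_ker.1 hx, map_zero])

variable [IsArtinianRing Aᵐᵒᵖ]

theorem isSimpleModule_simpleAt (he : IsCompletePrimitive e) (j : Fin n) :
    IsSimpleModule Aᵐᵒᵖ (simpleAt e j) :=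
  isSimpleModule_iff_isCoatom.2 (he.primitive j).isLargestProper.coatom

/-- If x e_k ≠ 0, it gives a surjection from e_kA to S(j). Its kernel is the radical of e_kA, so
S(k) ≅ S(j), against irredundancy. -/
theorem simpleAt_smul_eq_zero (he : IsCompletePrimitive e) {j k : Fin n} (hkj : k ≠ j)
    (x : simpleAt e j) : op (e k) • x = 0 := by
  by_contra hx
  have hS := isSimpleModule_simpleAt he j
  obtain ⟨f, hf⟩ := exists_hom_idealOf (e k) _ x
  have hf0 : f ≠ 0 := by
    rintro rfl
    exact hx hf.symm
  have hsurj : Function.Surjective f := LinearMap.surjective_of_ne_zero hf0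
  have hJ := (he.primitive k).isLargestProper
  have hker : LinearMap.ker f ≤ Module.jacobson Aᵐᵒᵖ (idealOf (e k)) :=
    hJ.le _ fun h => hf0 (LinearMap.ker_eq_top.1 h)
  have hbot : (Module.jacobson Aᵐᵒᵖ (idealOf (e k))).map f = ⊥ :=
    (eq_bot_or_eq_top _).resolve_right (hJ.map f hsurj hker).coatom.1
  have heq : LinearMap.ker f = Module.jacobson Aᵐᵒᵖ (idealOf (e k)) :=
    le_antisymm hker ((Submodule.map_le_iff_le_comap.1 hbot.le))
  exact hkj (he.injective k j ⟨LinearEquiv.toModuleIso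
    ((Submodule.quotEquivOfEq _ _ heq.symm).trans (f.quotKerEquivOfSurjective hsurj))⟩)

/-- For the converse, simple submodules are split off one at a time: if S(j) embeds in M, then p j
holds, because the generator of S(j) is fixed by e_j and nonzero. -/
theorem filtFamily_simpleAt_iff (he : IsCompletePrimitive e) (p : Fin n → Prop)
    (M : ModuleCat.{u} Aᵐᵒᵖ) :
    filtFamily (fun j : {j : Fin n // p j} => simpleAt e j) M ↔ SupportedOn e p M := by
  constructor
  · refine (extClosed_supportedOn he p).filtFamily_le (retractClosed_supportedOn p) fun j =>
      ⟨?_, fun k hk x => simpleAt_smul_eq_zero he (fun h => hk (by rw [h]; exact j.2)) x⟩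
    have := isSimpleModule_simpleAt he j
    infer_instance
  · have key : ∀ (m : ℕ) (M : ModuleCat.{u} Aᵐᵒᵖ), SupportedOn e p M →
        Module.length Aᵐᵒᵖ M ≤ m →
        filtFamily (fun j : {j : Fin n // p j} => simpleAt e j) M := by
      intro m
      induction m with
      | zero =>
        intro M _ hm
        exact (extClosed_filtFamily _).zero _
          (Module.length_eq_zero_iff.1 (le_antisymm hm bot_le))
      | succ m ih =>
        intro M hM hm
        rcases subsingleton_or_nontrivial M with h0 | h0
        · exact (extClosed_filtFamily _).zero _ h0
        have hfin := hM.1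
        obtain ⟨T, hT, -⟩ := (eq_bot_or_exists_atom_le (⊤ : Submodule Aᵐᵒᵖ M)).resolve_left
          top_ne_bot
        have hTs : IsSimpleModule Aᵐᵒᵖ T := isSimpleModule_iff_isAtom.2 hT
        obtain ⟨j, ⟨φ⟩⟩ := he.exhaustive (ModuleCat.of Aᵐᵒᵖ T) hTs
        have hpj : p j := by
          by_contra hj
          let g : simpleAt e j := Submodule.Quotient.mk (idealGen (e j))
          have hg : op (e j) • g = g :=
            congrArg (Submodule.Quotient.mk (p := Module.jacobson Aᵐᵒᵖ (idealOf (e j))))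
              (idealGen_smul (he.primitive j).1)
          have hg0 : g = 0 := by
            have h1 : φ.inv.hom g = 0 := by
              rw [← hg, map_smul]
              exact Subtype.ext (hM.2 j hj _)
            have h2 : φ.hom.hom (φ.inv.hom g) = g :=
              congrArg (fun t : simpleAt e j ⟶ simpleAt e j => t.hom g) φ.inv_hom_id
            rw [← h2, h1, map_zero]
          have h3 : idealGen (e j) ∈ Module.jacobson Aᵐᵒᵖ (idealOf (e j)) :=
            (Submodule.Quotient.mk_eq_zero _).1 hg0
          refine (he.primitive j).isLargestProper.coatom.1 (eq_top_iff.2 ?_)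
          rw [← span_idealGen, Submodule.span_le]
          simpa using h3
        refine (extClosed_filtFamily _).ext (IsSES.mkQ T)
          ((extClosed_filtFamily _).of_linearEquiv φ.symm.toLinearEquiv
            (filtFamily_self (fun j : {j : Fin n // p j} => simpleAt e j) ⟨j, hpj⟩)) (ih _ ⟨?_, ?_⟩ ?_)
        · exact inferInstanceAs (Module.Finite Aᵐᵒᵖ (M ⧸ T))
        · intro k hk x
          obtain ⟨x, rfl⟩ := Submodule.Quotient.mk_surjective T x
          exact congrArg (Submodule.Quotient.mk (p := T)) (hM.2 k hk x)
        · have h2 := (Submodule.length_quotient_lt T hT.1).trans_le hm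
          exact Order.le_of_lt_add_one (by simpa using h2)
    intro hM
    have := hM.1
    obtain ⟨m, hm⟩ := ENat.ne_top_iff_exists.1 (Module.length_ne_top (R := Aᵐᵒᵖ) (M := M))
    exact key m M hM hm.ge

/-- The kernel of e_iA → Δ(i) is generated by the elements x e_k with k > i. It lies in the radical,
as S(i) e_k = 0, so Δ(i) is local; and it has no nonzero map to a module killed by these e_k, so
projectivity of e_iA yields the Ext vanishing. -/
theorem standard_facts (he : IsCompletePrimitive e) (i : Fin n) :
    StandardLike e i (standard e i) ∧ StoneLike e i (standard e i) := by
  have hidem : ∀ k, IsIdempotentElem (e k) := fun k => (he.primitive k).1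
  have hfin : Module.Finite Aᵐᵒᵖ (idealOf (e i)) := finite_idealOf
  have hproj := projective_idealOf (hidem i)
  set 𝒰 := {U : Submodule Aᵐᵒᵖ (idealOf (e i)) |
    filtFamily (fun j : {j : Fin n // j ≤ i} => simpleAt e j)
      (ModuleCat.of Aᵐᵒᵖ (idealOf (e i) ⧸ U))} with h𝒰
  have hmem : ∀ U, U ∈ 𝒰 ↔ ∀ k, i < k → ∀ x ∈ (⊤ : Submodule Aᵐᵒᵖ (idealOf (e i))),
      op (e k) • x ∈ U := by
    intro U
    rw [h𝒰, Set.mem_ofPred_eq, filtFamily_simpleAt_iff he (fun j => j ≤ i)]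
    constructor
    · intro h k hk x _
      exact (Submodule.Quotient.mk_eq_zero U).1 (h.2 k (not_le.2 hk) (Submodule.Quotient.mk x))
    · intro h
      refine ⟨inferInstanceAs (Module.Finite Aᵐᵒᵖ (idealOf (e i) ⧸ U)), fun k hk x => ?_⟩
      obtain ⟨x, rfl⟩ := Submodule.Quotient.mk_surjective U x
      exact (Submodule.Quotient.mk_eq_zero U).2 (h k (not_le.1 hk) x trivial)
  obtain ⟨h1, h2⟩ := sInf_of_forall_iff hidem ⊤ (fun k => i < k) 𝒰 hmem
  have hJ := (he.primitive i).isLargestProper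
  have hN : sInf 𝒰 ≤ Module.jacobson Aᵐᵒᵖ (idealOf (e i)) := by
    refine sInf_le ((hmem _).2 fun k hk x _ => ?_)
    exact (Submodule.Quotient.mk_eq_zero _).1
      (simpleAt_smul_eq_zero he hk.ne' (Submodule.Quotient.mk x))
  have hst : StoneLike e i (standard e i) := fun Y hY =>
    .of_extends (IsSES.mkQ (sInf 𝒰)) .of_projective fun φ => ⟨0, fun x => by
      rw [h2 Y hY φ]; rfl⟩
  refine ⟨⟨inferInstanceAs (Module.Finite Aᵐᵒᵖ (idealOf (e i) ⧸ sInf 𝒰)), ?_, ?_, ?_, ?_⟩, hst⟩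
  · refine ⟨Submodule.Quotient.mk (idealGen (e i)),
      congrArg (Submodule.Quotient.mk (p := sInf 𝒰)) (idealGen_smul (hidem i)), ?_⟩
    have h1 := congrArg (Submodule.map (sInf 𝒰).mkQ) (span_idealGen (e := e i))
    rw [Submodule.map_span, Set.image_singleton, Submodule.map_top, Submodule.range_mkQ] at h1
    exact h1
  · intro k hk x
    obtain ⟨x, rfl⟩ := Submodule.Quotient.mk_surjective (sInf 𝒰) x
    exact (Submodule.Quotient.mk_eq_zero (sInf 𝒰)).2 (h1 k hk x trivial)
  · exact fun Y hY => hst Y fun k hk => hY k hk.le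
  · exact ⟨_, hJ.map (sInf 𝒰).mkQ (Submodule.mkQ_surjective _) (by rwa [Submodule.ker_mkQ])⟩

/-- The same argument one level down, with Δ(i) in place of e_iA: the submodule factored out is
generated by the elements x e_k with x in the radical J and k ≥ i. -/
theorem properStandard_facts (he : IsCompletePrimitive e) (i : Fin n) :
    StandardLike e i (properStandard e i) ∧ ProperLike e i (properStandard e i) := by
  have hidem : ∀ k, IsIdempotentElem (e k) := fun k => (he.primitive k).1
  have hM := (standard_facts he i).1
  unfold properStandard
  generalize standard e i = M at hM
  obtain ⟨J, hJ⟩ := hM.isLocal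
  have hfin := hM.finite
  set 𝒰 := {U : Submodule Aᵐᵒᵖ M |
    filtFamily (fun j : {j : Fin n // j < i} => simpleAt e j)
      (rad (ModuleCat.of Aᵐᵒᵖ (M ⧸ U)))} with h𝒰
  have hmem : ∀ U, U ∈ 𝒰 ↔ ∀ k, i ≤ k → ∀ x ∈ J, op (e k) • x ∈ U := by
    intro U
    rw [h𝒰, Set.mem_ofPred_eq, filtFamily_simpleAt_iff he (fun j => j < i)]
    have hfinU : Module.Finite Aᵐᵒᵖ (rad (ModuleCat.of Aᵐᵒᵖ (M ⧸ U))) :=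
      inferInstanceAs (Module.Finite Aᵐᵒᵖ (Module.jacobson Aᵐᵒᵖ (M ⧸ U)))
    -- The formula rad(M/U) = image of J needs U inside J, that is, U proper; the zero quotient is
    -- treated separately.
    by_cases hU : U = ⊤
    · have : Subsingleton (M ⧸ U) := Submodule.Quotient.subsingleton_iff.2 hU
      refine iff_of_true ⟨hfinU, fun k _ x => Subtype.ext ?_⟩ fun k _ x _ => hU ▸ trivial
      exact Subsingleton.elim (α := M ⧸ U) _ _
    have hJU : Module.jacobson Aᵐᵒᵖ (M ⧸ U) = J.map U.mkQ := by
      rw [Module.jacobson_quotient_of_le (by rw [hJ.jacobson_eq]; exact hJ.le U hU), hJ.jacobson_eq]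
    constructor
    · intro h k hk x hx
      have hx' : U.mkQ x ∈ Module.jacobson Aᵐᵒᵖ (M ⧸ U) := by
        rw [hJU]; exact ⟨x, hx, rfl⟩
      exact (Submodule.Quotient.mk_eq_zero U).1
        (congrArg Subtype.val (h.2 k (not_lt.2 hk) ⟨_, hx'⟩))
    · intro h
      refine ⟨hfinU, fun k hk x => ?_⟩
      obtain ⟨x, hx⟩ := x
      have hx2 := hx
      change x ∈ Module.jacobson Aᵐᵒᵖ (M ⧸ U) at hx2
      rw [hJU] at hx2
      obtain ⟨y, hy, rfl⟩ := hx2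
      exact Subtype.ext ((Submodule.Quotient.mk_eq_zero U).2 (h k (not_lt.1 hk) y hy))
  obtain ⟨h1, h2⟩ := sInf_of_forall_iff hidem J (fun k => i ≤ k) 𝒰 hmem
  have hN : sInf 𝒰 ≤ J := sInf_le ((hmem J).2 fun k _ x hx => J.smul_mem _ hx)
  refine ⟨hM.quotient (sInf 𝒰) (fun h => hJ.coatom.1 (top_le_iff.1 (h ▸ hN))) h2,
    _, hJ.map (sInf 𝒰).mkQ (Submodule.mkQ_surjective _) (by rwa [Submodule.ker_mkQ]), ?_⟩
  rintro k hk _ ⟨y, hy, rfl⟩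
  exact (Submodule.Quotient.mk_eq_zero (sInf 𝒰)).2 (h1 k hk y hy)

/-- Since g = g e_i and J e_i = 0, a nonzero endomorphism cannot send the generator g into J. It is
therefore onto, and injective because M is Noetherian. -/
theorem StandardLike.linBrick (h : StandardLike e i M) (hp : ProperLike e i M) : LinBrick M := by
  obtain ⟨J, hJ, hk⟩ := hp
  obtain ⟨g, hg, hs⟩ := h.gen
  have hfin := h.finite
  refine ⟨hJ.nontrivial, fun f hf => ?_⟩
  have hfg : f g ∉ J := fun hfg => hf (LinearMap.ext_on hs fun x hx => by
    rw [Set.mem_singleton_iff.1 hx, ← hg, map_smul, hk i le_rfl _ hfg]; rfl)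
  have hsurj : Function.Surjective f := LinearMap.range_eq_top.1 (by
    by_contra hne
    exact hfg (hJ.le _ hne ⟨g, rfl⟩))
  exact ⟨IsNoetherian.injective_of_surjective_endomorphism f hsurj, hsurj⟩

theorem isExceptionalFamily_of_standardLike
    {Θ : Fin n → ModuleCat.{u} Aᵐᵒᵖ} (h : ∀ i, StandardLike e i (Θ i))
    (h' : ∀ i, StoneLike e i (Θ i) ∨ ProperLike e i (Θ i)) : IsExceptionalFamily Θ where
  finite i := (h i).finite
  indec i := (h i).isLocal.choose_spec.indec
  brick_or_stone i := (h' i).symm.imp (fun hp => ⟨(h i).linBrick hp, (h i).liftsTops hp⟩)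
    fun hs => hs _ (h i).kills
  hom i j hij := (h i).hom_eq_zero ((h j).kills i hij)
  ext i j hij := (h i).ext _ fun k hik => (h j).kills k (hij.trans_le hik)

end Standard

end MixedStrat

/-! ### Mixed (bi)stratifying systems from (proper) standard modules -/

open MixedStrat in
theorem corollary3p20 {𝕜 : Type*} [Field 𝕜] {A : Type*} [Ring A] [Algebra 𝕜 A]
    [FiniteDimensional 𝕜 A] {n : ℕ} (e : Fin n → A) (he : MixedStrat.IsCompletePrimitive e)
    (Θ : Fin n → ModuleCat Aᵐᵒᵖ)
    (hΘ : ∀ i, Nonempty (Θ i ≅ MixedStrat.standard e i) ∨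
      Nonempty (Θ i ≅ MixedStrat.properStandard e i)) :
    ∃ P : Fin n → ModuleCat Aᵐᵒᵖ,
      MixedStrat.IsProjectiveIn (MixedStrat.filtFamily Θ) (MixedStrat.directSum P) ∧
      MixedStrat.IsMixedStratifyingSystem Θ P ∧
      ((∀ i, Nonempty (Θ i ≅ MixedStrat.standard e i)) →
        ∃ I : Fin n → ModuleCat Aᵐᵒᵖ,
          MixedStrat.IsInjectiveIn (MixedStrat.filtFamily Θ) (MixedStrat.directSum I) ∧
          MixedStrat.IsMixedBistratifyingSystem Θ P I) := by
  have : IsArtinianRing Aᵐᵒᵖ := IsArtinianRing.of_finite 𝕜 _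
  have hstd : ∀ i, StandardLike e i (Θ i) := fun i => by
    rcases hΘ i with ⟨⟨φ⟩⟩ | ⟨⟨φ⟩⟩
    · exact (standard_facts he i).1.of_linearEquiv φ.symm.toLinearEquiv
    · exact (properStandard_facts he i).1.of_linearEquiv φ.symm.toLinearEquiv
  have hfam : IsExceptionalFamily Θ := isExceptionalFamily_of_standardLike hstd fun i => by
    rcases hΘ i with ⟨⟨φ⟩⟩ | ⟨⟨φ⟩⟩
    · exact .inl ((standard_facts he i).2.of_linearEquiv φ.symm.toLinearEquiv)
    · exact .inr ((properStandard_facts he i).2.of_linearEquiv φ.symm.toLinearEquiv)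
  obtain ⟨P, hP, hΘP⟩ := hfam.exists_stratifying 𝕜
  refine ⟨P, hP, hΘP, fun hall => ?_⟩
  -- Each Θ i is itself killed by e_k for k > i, so its stone-like Ext vanishing applies to Θ i and
  -- rules out self-extensions.
  obtain ⟨I, hI, hΘI⟩ := hfam.exists_costratifying 𝕜 fun i => by
    obtain ⟨φ⟩ := hall i
    exact (standard_facts he i).2.of_linearEquiv φ.symm.toLinearEquiv _ (hstd i).kills
  exact ⟨I, hI, hΘP, hΘI⟩
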